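/- Let $\Gamma$ be a locally finite vertex-transitive simple graph with a distinguished vertex $o$, let $p\in(0,1]$, and let $\mathrm{perc}(\Gamma,p)$ be the random graph with the same vertex set obtained by keeping each edge of $\Gamma$ independently with probability $p$ and removing it otherwise (and similarly for other graphs). For a graph $H$ of bounded degree with adjacency operator $A$ (given by $Ae_x=\sum_{y\sim x}e_y$) and a vertex $x$, let $\mu_H^{e_x}$ be its spectral measure at $x$, i.e. the unique probability measure on $\mathbb{R}$ with $\int \lambda^k\,d\mu_H^{e_x}(\lambda)=\langle e_x,A^k e_x\rangle$ for all integers $k\ge 0$. Assume that, with positive probability, $\mu^{e_o}_{\mathrm{perc}(\Gamma,p)}$ has an absolutely continuous part of positive mass (with respect to Lebesgue measure), and let $\bar\mu_s(\mathbb{R})$ be the expected mass of its singular part. For a graph $G$, a vertex $v$ and an integer $h\ge1$, let $(G,v)_h$ be the subgraph of $G$ induced by the vertices at graph distance at most $h$ from $v$, rooted at $v$. For $G$ finite with vertex set $V$, $|V|=n$, let $B_\Gamma(h)$ be the number of vertices $v\in V$ such that $(G,v)_h$ is not isomorphic, as a rooted graph, to $(\Gamma,o)_h$; let $N_h(G,v)$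 be the number of vertices of $(G,v)_h$ and $M_h(G)=\big(\frac1n\sum_{v\in V}N_h(G,v)^2\big)^{1/2}$. A unit vector $\psi\in\mathbb{C}^V$ is called $(\rho,\kappa)$-delocalized if there is $S\subset V$ with $\sum_{v\in S}|\psi(v)|^2\ge\rho$ and $|\psi(v)|\le\kappa$ for all $v\in S$. Then for every integer $d\ge2$ and every $\varepsilon>0$ there exist constants $c_0,c_1,\alpha,\rho>0$, depending only on $\varepsilon$, $d$, $\Gamma$ and $p$, such that the following holds for every finite graph $G$ with $n$ vertices and maximal degree $d$, every integer $h\ge1$ and every real $\delta\ge\max\big(\frac{h\,B_\Gamma(h)}{n},\frac1h\big)$. With probability at least $$1-\delta^{-1}h^2\exp\Big(-\frac{n\delta^2}{2h^2M_h(G)^2}\Big),$$ every orthonormal basis of eigenvectors of the adjacency matrix of $\mathrm{perc}(G,p)$ satisfies: (i) if $\delta\le c_0$, then at least $\alpha n$ vectors of the basis are $\big(\rho,\,c_1\sqrt{\tfrac{\log h}{h}}\big)$-delocalized; (ii) with $\beta=1-\sqrt{4\pi\,(\bar\mu_s(\mathbb{R})+\varepsilon+\delta)}$, at least $\beta n$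 vectors of the basis are $\big(\beta,\,c_1\sqrt{\tfrac{\log h}{h}}\big)$-delocalized (this is void when $\beta\le0$). -/

import Mathlib

open MeasureTheory ProbabilityTheory

universe u v

noncomputable section

namespace QuantumPercolation

/-! ### Graphs and rooted balls -/

/-- `Γ` is vertex transitive: its automorphism group acts transitively on the vertices. -/
def IsVertexTransitive {U : Type*} (Γ : SimpleGraph U) : Prop :=
  ∀ x y : U, ∃ φ : Γ ≃g Γ, φ x = y

/-- The set of vertices at graph distance at most `h` from `v`. The extended distance is used, so
that vertices in other connected components are at distance `∞`. -/
def ballSet {V : Type*} (G : SimpleGraph V) (v : V) (h : ℕ) : Set V :=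
  {u | G.edist v u ≤ (h : ℕ∞)}

/-- The rooted graphs `(G, v)_h` and `(Γ, o)_h` (subgraphs induced on the balls of radius `h`,
rooted at their centres) are isomorphic. -/
def BallIso {V U : Type*} (G : SimpleGraph V) (v : V) (Γ : SimpleGraph U) (o : U) (h : ℕ) : Prop :=
  ∃ φ : G.induce (ballSet G v h) ≃g Γ.induce (ballSet Γ o h),
    ∀ x : ballSet G v h, (x : V) = v → (φ x : U) = o

/-- `B_Γ(h)`: the number of vertices `v` of `G` such that `(G, v)_h` is not isomorphic
to `(Γ, o)_h`. -/
def badCount {V U : Type*} (G : SimpleGraph V) (Γ : SimpleGraph U) (o : U) (h : ℕ) : ℕ :=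
  {v : V | ¬ BallIso G v Γ o h}.ncard

/-- `N_h(G, v)`: the number of vertices at distance at most `h` from `v`. -/
def ballCard {V : Type*} (G : SimpleGraph V) (v : V) (h : ℕ) : ℕ :=
  (ballSet G v h).ncard

/-- `M_h(G)`: the quadratic average of `N_h(G, v)` over the vertices. -/
def ballQuadMean {V : Type*} [Fintype V] (G : SimpleGraph V) (h : ℕ) : ℝ :=
  Real.sqrt ((1 / (Fintype.card V : ℝ)) * ∑ v : V, (ballCard G v h : ℝ) ^ 2)

/-! ### Bond percolation -/

/-- The law of independent Bernoulli(`p`) variables attached to the edges of `G`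
(`true` means that the edge is kept). -/
def edgeLaw {V : Type*} (G : SimpleGraph V) (p : unitInterval) : Measure (G.edgeSet → Bool) :=
  Measure.infinitePi fun _ => bernoulliMeasure true false p

/-- The subgraph of `G` formed by all vertices and the edges kept in the configuration `ω`.
Under `edgeLaw G p`, this random graph is `perc(G, p)`. -/
def percGraph {V : Type*} (G : SimpleGraph V) (ω : G.edgeSet → Bool) : SimpleGraph V where
  Adj x y := ∃ hxy : G.Adj x y, ω ⟨s(x, y), hxy⟩ = true
  symm := ⟨by
    rintro x y ⟨hxy, hω⟩
    refine ⟨hxy.symm, ?_⟩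
    rw [← hω]
    congr 2
    exact Sym2.eq_swap⟩
  loopless := ⟨fun x hx => G.loopless.irrefl x hx.1⟩

/-! ### Adjacency operator and spectral measures -/

/-- The adjacency operator of a locally finite graph on finitely supported functions:
`A e_x = ∑_{y ∼ x} e_y`. -/
def adjOp {U : Type*} (H : SimpleGraph U) : (U →₀ ℂ) →ₗ[ℂ] (U →₀ ℂ) :=
  Finsupp.linearCombination ℂ fun x => ∑ᶠ y ∈ H.neighborSet x, Finsupp.single y (1 : ℂ)

/-- `μ` is a probability measure on `ℝ` with finite moments `∫ t ^ k dμ = ⟨e_x, A ^ k e_x⟩`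
for all `k`, where `A` is the adjacency operator of `H`. -/
structure IsSpectralMeasure {U : Type*} (H : SimpleGraph U) (x : U) (μ : Measure ℝ) : Prop where
  isProb : IsProbabilityMeasure μ
  integrable : ∀ k : ℕ, Integrable (fun t : ℝ => t ^ k) μ
  moment : ∀ k : ℕ, ((∫ t : ℝ, t ^ k ∂μ : ℝ) : ℂ) = ((adjOp H ^ k) (Finsupp.single x 1)) x

open Classical in
/-- The spectral measure `μ_H^{e_x}`. For graphs of bounded degree, the adjacency operator is
bounded and self-adjoint, and there is exactly one measure satisfying `IsSpectralMeasure H x`. -/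
def spectralMeasure {U : Type*} (H : SimpleGraph U) (x : U) : Measure ℝ :=
  if hμ : ∃ μ : Measure ℝ, IsSpectralMeasure H x μ then hμ.choose else 0

/-- `μ` has an absolutely continuous part of positive mass (with respect to Lebesgue measure). -/
def HasACPart (μ : Measure ℝ) : Prop :=
  0 < (volume.withDensity (μ.rnDeriv volume)) Set.univ

/-- The expected mass of the singular part of the spectral measure at the root of `perc(Γ, p)`. -/
def expectedSingularMass {U : Type*} (Γ : SimpleGraph U) (o : U) (p : unitInterval) : ℝ :=
  (∫⁻ ω, ((spectralMeasure (percGraph Γ ω) o).singularPart volume) Set.univ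
    ∂(edgeLaw Γ p)).toReal

/-! ### Eigenvectors and delocalization -/

open Classical in
/-- All the vectors of the orthonormal basis `ψ` are eigenvectors of the adjacency matrix
of `H`. -/
def IsEigenbasis {V : Type*} [Fintype V] (H : SimpleGraph V)
    (ψ : OrthonormalBasis (Fin (Fintype.card V)) ℂ (EuclideanSpace ℂ V)) : Prop :=
  ∀ k, ∃ lam : ℂ, (H.adjMatrix ℂ).mulVec (ψ k).ofLp = lam • (ψ k).ofLp

/-- The unit vector `ψ` is `(ρ, ε)`-delocalized. -/
def IsDelocalized {V : Type*} [Fintype V] (ρ ε : ℝ) (ψ : EuclideanSpace ℂ V) : Prop :=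
  ∃ S : Finset V, ρ ≤ ∑ i ∈ S, ‖ψ i‖ ^ 2 ∧ ∀ i ∈ S, ‖ψ i‖ ≤ ε

/-- The number of vectors of the orthonormal basis `ψ` that are `(ρ, ε)`-delocalized. -/
def delocalizedCount {V : Type*} [Fintype V] (ρ ε : ℝ)
    (ψ : OrthonormalBasis (Fin (Fintype.card V)) ℂ (EuclideanSpace ℂ V)) : ℕ :=
  {k | IsDelocalized ρ ε (ψ k)}.ncard

end QuantumPercolation

end

/-!
Write `A` for the adjacency operator of a graph `H` with degrees at most `R`, and call *excess* at a
vertex `x` the sum over `j` of the parts above `L / (2 m)` of the numbers `⟨e_x, P_j(A) e_x⟩`, where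
`P_0, …, P_{2m-1}` are nonnegative polynomials of degree at most `2 m - 2` forming a partition of
unity on `[-R, R]`. They are squared Fejér kernels in the variable `arccos (t / R)`, so that
`∫ P_j ≤ π R / (2 m)` and `∑ √P_j ≤ 3` (`exists_isPolyPartition`).

* Eigenvectors see the excess. On a finite graph with eigenbasis `ψ`, the squared mass
  `∑ |ψ_k(x)|²` over those `k` with `|ψ_k(x)| > κ` is at most the excess at `x` plus
  `3 √(L / (2 m)) / κ` (`sum_large_sq_le_excess`). The bound on `∑ √P_j` makes tail estimates for the
  kernels unnecessary.
* The excess is local. With `2 m - 2 ≤ h` it depends only on the percolated ball of radius `h`, so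
  its mean is the same at `x` in `perc(G, p)` and at `o` in `perc(Γ, p)` whenever the two balls are
  isomorphic (`integral_excess_eq_of_ballIso`).
* On the infinite graph, the part of the spectral density below `K` gives at most `K π R / (2 m)` to
  each term. Hence for `L = K π R` the excess is at most the mass of the singular part plus the mass
  of the part of the density above `K`, whatever `m` is, and the mean of the latter tends to `0` as
  `K → ∞` (`exists_integral_excess_le`). Measurability of the Lebesgue decomposition in the
  configuration comes from that of the spectral measure, which is obtained from its moments by
  Weierstrass approximation.
* The total excess over a finite graph is a function of independent edge variables, the edge `e`
  influencing at most `N_h(G, v)` vertices for an endpoint `v` of `e`. The bounded differences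
  inequality shows that it exceeds its mean by at most `n δ` with the required probability
  (`measure_sum_excess_ge_le`).

On that event, Markov's inequality over the eigenvectors yields both conclusions
(`delocalization_of_sum_excess_lt`). Radii `h` below `d` are absorbed in the constant `c₁`, which
makes every unit vector delocalized there, and `δ ≥ 1` makes both conclusions void.
-/

noncomputable section

namespace QuantumPercolation

open Polynomial Filter Topology

/-! ### A polynomial partition of unity on an interval -/

/-- The frequency `k - l + k' - l'` attached to a quadruple of indices. -/
def freq {m : ℕ} (q : (Fin m × Fin m) × (Fin m × Fin m)) : ℤ :=
  ((q.1.1 : ℤ) - q.1.2) + ((q.2.1 : ℤ) - q.2.2)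

/-- The number of quadruples `(k, l, k', l')` in `{0, …, m - 1}` with `k + k' = l + l'`. -/
def zeroFreqCount (m : ℕ) : ℕ :=
  (Finset.univ.filter fun q : (Fin m × Fin m) × (Fin m × Fin m) => freq q = 0).card

/-- The (unnormalised) Fejér kernel `∑_{k, l < m} cos ((k - l) x)`. -/
def fejer (m : ℕ) (x : ℝ) : ℝ :=
  ∑ q : Fin m × Fin m, Real.cos (((q.1 : ℝ) - q.2) * x)

lemma fejer_nonneg (m : ℕ) (x : ℝ) : 0 ≤ fejer m x := by
  have : fejer m x = (∑ k : Fin m, Real.cos (k * x)) ^ 2 + (∑ k : Fin m, Real.sin (k * x)) ^ 2 := by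
    simp only [fejer, sq, Finset.sum_mul_sum, ← Finset.sum_add_distrib, Fintype.sum_prod_type,
      sub_mul, Real.cos_sub]
  rw [this]
  positivity

/-- The square of the Fejér kernel as a cosine sum; the sine part cancels by antisymmetry. -/
lemma fejer_sq (m : ℕ) (x : ℝ) :
    fejer m x ^ 2 = ∑ q : (Fin m × Fin m) × (Fin m × Fin m), Real.cos (freq q * x) := by
  have hs : ∑ q : Fin m × Fin m, Real.sin (((q.1 : ℝ) - q.2) * x) = 0 := by
    simp only [Fintype.sum_prod_type, sub_mul, Real.sin_sub, Finset.sum_sub_distrib,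
      ← Finset.sum_mul_sum]
    ring
  have h : ∀ q : (Fin m × Fin m) × (Fin m × Fin m), Real.cos (freq q * x) =
      Real.cos (((q.1.1 : ℝ) - q.1.2) * x) * Real.cos (((q.2.1 : ℝ) - q.2.2) * x) -
      Real.sin (((q.1.1 : ℝ) - q.1.2) * x) * Real.sin (((q.2.1 : ℝ) - q.2.2) * x) := by
    intro q
    rw [← Real.cos_add]
    congr 1
    simp only [freq]
    push_cast
    ring
  have hprod : ∀ f : Fin m × Fin m → ℝ,
      ∑ q : (Fin m × Fin m) × (Fin m × Fin m), f q.1 * f q.2 = (∑ q, f q) * ∑ q, f q := by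
    intro f
    rw [Finset.sum_mul_sum, Fintype.sum_prod_type]
  simp_rw [h]
  rw [Finset.sum_sub_distrib, hprod (fun q => Real.cos (((q.1 : ℝ) - q.2) * x)),
    hprod (fun q => Real.sin (((q.1 : ℝ) - q.2) * x)), hs, fejer]
  ring

/-- Discrete orthogonality: equidistant nodes integrate `cos (n ·)` exactly for `|n| < 2 m`. -/
lemma sum_cos_node {m : ℕ} (hm : 0 < m) {n : ℤ} (hn : |n| < 2 * m) :
    ∑ j : Fin (2 * m), Real.cos (n * (Real.pi * j / m)) = if n = 0 then 2 * (m : ℝ) else 0 := by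
  split_ifs with h0
  · simp [h0]
  have hm' : (m : ℝ) ≠ 0 := by positivity
  set a : ℝ := n * Real.pi / m with ha
  have hsin : Real.sin (a / 2) ≠ 0 := by
    rw [Ne, Real.sin_eq_zero_iff]
    rintro ⟨k, hk⟩
    have hk' : (2 * m * k : ℝ) = n := by
      have := Real.pi_ne_zero
      rw [ha] at hk
      field_simp at hk
      nlinarith [hk]
    have hk2 : 2 * (m : ℤ) * k = n := by exact_mod_cast hk'
    have hk0 : k ≠ 0 := by
      rintro rfl
      simp at hk2
      exact h0 hk2.symm
    have h1 : 1 ≤ |k| := Int.one_le_abs hk0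
    have h2 : |n| = 2 * m * |k| := by
      rw [← hk2, abs_mul, abs_of_nonneg (by positivity : (0 : ℤ) ≤ 2 * m)]
    nlinarith
  have htel : ∀ N : ℕ, 2 * Real.sin (a / 2) * ∑ j ∈ Finset.range N, Real.cos (j * a) =
      Real.sin ((N - 1 / 2) * a) + Real.sin (a / 2) := by
    intro N
    induction N with
    | zero =>
      have : ((0 : ℕ) - 1 / 2 : ℝ) * a = -(a / 2) := by push_cast; ring
      simp only [Finset.range_zero, Finset.sum_empty, this, Real.sin_neg]
      ring
    | succ N ih =>
      rw [Finset.sum_range_succ, mul_add, ih]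
      have e1 : ((N + 1 : ℕ) - 1 / 2 : ℝ) * a = N * a + a / 2 := by push_cast; ring
      have e2 : (N - 1 / 2 : ℝ) * a = N * a - a / 2 := by ring
      rw [e1, e2, Real.sin_add, Real.sin_sub]
      ring
  have h2 := htel (2 * m)
  have e3 : (((2 * m : ℕ) : ℝ) - 1 / 2) * a = n * (2 * Real.pi) - a / 2 := by
    rw [ha]; push_cast; field_simp
  rw [e3, Real.sin_int_mul_two_pi_sub, neg_add_cancel] at h2
  have h3 : ∑ j ∈ Finset.range (2 * m), Real.cos (j * a) = 0 := by
    rcases mul_eq_zero.mp h2 with h | h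
    · exact absurd h (by simpa using hsin)
    · exact h
  rw [← h3, ← Fin.sum_univ_eq_sum_range (fun j => Real.cos (j * a))]
  refine Finset.sum_congr rfl fun j _ => ?_
  rw [ha]
  congr 1
  ring

lemma abs_freq_lt {m : ℕ} (q : (Fin m × Fin m) × (Fin m × Fin m)) : |freq q| < 2 * m := by
  simp only [freq, abs_lt]
  have := q.1.1.2; have := q.1.2.2; have := q.2.1.2; have := q.2.2.2
  omega

/-- Cauchy–Schwarz for the number of representations of `s < 2 m` as a sum `k + k'`. -/
lemma le_zeroFreqCount {m : ℕ} (hm : 0 < m) : (m : ℝ) ^ 3 ≤ 2 * zeroFreqCount m := by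
  classical
  let r : Fin (2 * m) → ℕ := fun s =>
    (Finset.univ.filter fun q : Fin m × Fin m => (q.1 : ℕ) + q.2 = s).card
  have hr : ∑ s, r s = m ^ 2 := by
    have := Finset.card_eq_sum_card_fiberwise (s := (Finset.univ : Finset (Fin m × Fin m)))
      (t := (Finset.univ : Finset (Fin (2 * m))))
      (f := fun q => ⟨(q.1 : ℕ) + q.2, by have := q.1.2; have := q.2.2; omega⟩)
      (fun _ _ => Finset.mem_coe.2 (Finset.mem_univ _))
    simp only [Finset.card_univ, Fintype.card_prod, Fintype.card_fin, Fin.ext_iff] at this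
    rw [sq, this]
  have hr2 : ∑ s, r s ^ 2 = zeroFreqCount m := by
    have h1 : zeroFreqCount m = (Finset.univ.filter fun q : (Fin m × Fin m) × (Fin m × Fin m) =>
        (q.1.1 : ℕ) + q.1.2 = (q.2.1 : ℕ) + q.2.2).card := by
      refine Finset.card_equiv
        ⟨fun q => ((q.1.1, q.2.1), (q.1.2, q.2.2)), fun q => ((q.1.1, q.2.1), (q.1.2, q.2.2)),
          fun _ => rfl, fun _ => rfl⟩ ?_
      intro q
      simp only [Finset.mem_filter, Finset.mem_univ, true_and, Equiv.coe_fn_mk]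
      simp only [freq]
      omega
    rw [h1, Finset.card_eq_sum_card_fiberwise (t := (Finset.univ : Finset (Fin (2 * m))))
      (f := fun q => ⟨(q.1.1 : ℕ) + q.1.2, by have := q.1.1.2; have := q.1.2.2; omega⟩)
      (fun _ _ => Finset.mem_coe.2 (Finset.mem_univ _))]
    refine Finset.sum_congr rfl fun s _ => ?_
    rw [sq, ← Finset.card_product]
    congr 1
    ext q
    simp only [Finset.mem_product, Finset.mem_filter, Finset.mem_univ, true_and, Fin.ext_iff]
    omega
  have hcs := sq_sum_le_card_mul_sum_sq (s := (Finset.univ : Finset (Fin (2 * m))))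
    (f := fun s => (r s : ℝ))
  have e1 : ∑ s, (r s : ℝ) = (m : ℝ) ^ 2 := by exact_mod_cast hr
  have e2 : ∑ s, (r s : ℝ) ^ 2 = (zeroFreqCount m : ℝ) := by exact_mod_cast hr2
  rw [e1, e2, Finset.card_univ, Fintype.card_fin] at hcs
  push_cast at hcs
  have : (0 : ℝ) < m := by positivity
  nlinarith

/-- The polynomials whose values at `cos θ` are the symmetrised squared Fejér kernels centred at
the nodes `π j / m`. -/
def jacksonPoly (m : ℕ) (j : Fin (2 * m)) : ℝ[X] :=
  ∑ q : (Fin m × Fin m) × (Fin m × Fin m),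
    C ((1 / (2 * m * zeroFreqCount m) : ℝ) * Real.cos (freq q * (Real.pi * j / m))) *
      Chebyshev.T ℝ (freq q)

lemma eval_jacksonPoly (m : ℕ) (j : Fin (2 * m)) (θ : ℝ) :
    (jacksonPoly m j).eval (Real.cos θ) = (1 / (2 * m * zeroFreqCount m) : ℝ) *
      ∑ q : (Fin m × Fin m) × (Fin m × Fin m),
        Real.cos (freq q * (Real.pi * j / m)) * Real.cos (freq q * θ) := by
  simp only [jacksonPoly, eval_finsetSum, eval_mul, eval_C, Chebyshev.T_real_cos, Finset.mul_sum,
    mul_assoc]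

lemma eval_jacksonPoly_eq_fejer (m : ℕ) (j : Fin (2 * m)) (θ : ℝ) :
    (jacksonPoly m j).eval (Real.cos θ) = (1 / (4 * m * zeroFreqCount m) : ℝ) *
      (fejer m (θ - Real.pi * j / m) ^ 2 + fejer m (θ + Real.pi * j / m) ^ 2) := by
  rw [eval_jacksonPoly, fejer_sq, fejer_sq, ← Finset.sum_add_distrib]
  have h : ∀ q : (Fin m × Fin m) × (Fin m × Fin m),
      Real.cos (freq q * (θ - Real.pi * j / m)) + Real.cos (freq q * (θ + Real.pi * j / m)) =
        2 * (Real.cos (freq q * (Real.pi * j / m)) * Real.cos (freq q * θ)) := by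
    intro q
    rw [mul_sub, mul_add, Real.cos_sub, Real.cos_add]
    ring
  simp_rw [h]
  rw [← Finset.mul_sum, ← mul_assoc]
  congr 1
  ring

lemma natDegree_jacksonPoly_le {m : ℕ} (hm : 0 < m) (j : Fin (2 * m)) :
    (jacksonPoly m j).natDegree ≤ 2 * m - 2 := by
  refine natDegree_sum_le_of_forall_le _ _ fun q _ => ?_
  refine (natDegree_C_mul_le _ _).trans ?_
  rw [Chebyshev.natDegree_T]
  simp only [freq]
  have := q.1.1.2; have := q.1.2.2; have := q.2.1.2; have := q.2.2.2
  omega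

lemma eval_jacksonPoly_nonneg (m : ℕ) (j : Fin (2 * m)) {t : ℝ} (ht : t ∈ Set.Icc (-1 : ℝ) 1) :
    0 ≤ (jacksonPoly m j).eval t := by
  rw [← Real.cos_arccos ht.1 ht.2, eval_jacksonPoly_eq_fejer]
  positivity

lemma zeroFreqCount_pos {m : ℕ} (hm : 0 < m) : (0 : ℝ) < zeroFreqCount m := by
  have h1 := le_zeroFreqCount hm
  have : (0 : ℝ) < (m : ℝ) ^ 3 := by positivity
  linarith

lemma sum_jacksonPoly {m : ℕ} (hm : 0 < m) {t : ℝ} (ht : t ∈ Set.Icc (-1 : ℝ) 1) :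
    ∑ j, (jacksonPoly m j).eval t = 1 := by
  rw [← Real.cos_arccos ht.1 ht.2]
  simp_rw [eval_jacksonPoly]
  rw [← Finset.mul_sum, Finset.sum_comm]
  simp_rw [← Finset.sum_mul, sum_cos_node hm (abs_freq_lt _), ite_mul, zero_mul]
  rw [← Finset.sum_filter]
  have : ∀ q ∈ Finset.univ.filter
      (fun q : (Fin m × Fin m) × (Fin m × Fin m) => freq q = 0),
      2 * (m : ℝ) * Real.cos (freq q * Real.arccos t) = 2 * m := by
    intro q hq
    simp [(Finset.mem_filter.1 hq).2]
  rw [Finset.sum_congr rfl this, Finset.sum_const, nsmul_eq_mul, ← zeroFreqCount]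
  have := zeroFreqCount_pos hm
  have : (0 : ℝ) < m := by positivity
  field_simp

lemma sum_fejer_node {m : ℕ} (hm : 0 < m) (θ : ℝ) :
    ∑ j : Fin (2 * m), (fejer m (θ - Real.pi * j / m) + fejer m (θ + Real.pi * j / m)) =
      4 * (m : ℝ) ^ 2 := by
  have h : ∀ j : Fin (2 * m),
      fejer m (θ - Real.pi * j / m) + fejer m (θ + Real.pi * j / m) =
      ∑ q : Fin m × Fin m, 2 * Real.cos (((q.1 : ℝ) - q.2) * θ) *
        Real.cos (((q.1 - q.2 : ℤ) : ℝ) * (Real.pi * j / m)) := by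
    intro j
    rw [fejer, fejer, ← Finset.sum_add_distrib]
    refine Finset.sum_congr rfl fun q _ => ?_
    push_cast
    rw [mul_sub, mul_add, Real.cos_sub, Real.cos_add]
    ring
  simp_rw [h]
  rw [Finset.sum_comm]
  have h2 : ∀ q : Fin m × Fin m, |(q.1 - q.2 : ℤ)| < 2 * m := by
    intro q
    have := q.1.2; have := q.2.2
    rw [abs_lt]; omega
  simp_rw [← Finset.mul_sum, sum_cos_node hm (h2 _), mul_ite, mul_zero]
  rw [← Finset.sum_filter]
  have h3 : ∀ q ∈ Finset.univ.filter (fun q : Fin m × Fin m => (q.1 - q.2 : ℤ) = 0),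
      2 * Real.cos (((q.1 : ℝ) - q.2) * θ) * (2 * m) = 4 * m := by
    intro q hq
    have : ((q.1 : ℝ) - q.2) = 0 := by exact_mod_cast (Finset.mem_filter.1 hq).2
    rw [this, zero_mul, Real.cos_zero]
    ring
  rw [Finset.sum_congr rfl h3, Finset.sum_const, nsmul_eq_mul]
  have h4 : (Finset.univ.filter (fun q : Fin m × Fin m => (q.1 - q.2 : ℤ) = 0)).card = m := by
    have : (Finset.univ.filter (fun q : Fin m × Fin m => (q.1 - q.2 : ℤ) = 0)) =
        (Finset.univ : Finset (Fin m)).diag := by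
      ext q
      simp only [Finset.mem_filter, Finset.mem_univ, true_and, Finset.mem_diag, Fin.ext_iff]
      omega
    rw [this, Finset.diag_card, Finset.card_univ, Fintype.card_fin]
  rw [h4]
  ring

/-- The square roots of the partition of unity are again Fejér kernels, hence have bounded sum.
This replaces tail estimates for the kernels. -/
lemma sum_sqrt_jacksonPoly {m : ℕ} (hm : 0 < m) {t : ℝ} (ht : t ∈ Set.Icc (-1 : ℝ) 1) :
    ∑ j, Real.sqrt ((jacksonPoly m j).eval t) ≤ 3 := by
  rw [← Real.cos_arccos ht.1 ht.2]
  set θ := Real.arccos t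
  have hm' : (0 : ℝ) < m := by positivity
  have hQ := zeroFreqCount_pos hm
  have h1 : ∀ j : Fin (2 * m), Real.sqrt ((jacksonPoly m j).eval (Real.cos θ)) ≤
      Real.sqrt (1 / (4 * m * zeroFreqCount m)) *
        (fejer m (θ - Real.pi * j / m) + fejer m (θ + Real.pi * j / m)) := by
    intro j
    have ha := fejer_nonneg m (θ - Real.pi * j / m)
    have hb := fejer_nonneg m (θ + Real.pi * j / m)
    rw [eval_jacksonPoly_eq_fejer, Real.sqrt_mul (by positivity)]
    refine mul_le_mul_of_nonneg_left ?_ (Real.sqrt_nonneg _)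
    rw [Real.sqrt_le_left (by positivity)]
    nlinarith
  refine (Finset.sum_le_sum fun j _ => h1 j).trans ?_
  rw [← Finset.mul_sum, sum_fejer_node hm]
  have h2 : Real.sqrt (1 / (4 * m * zeroFreqCount m)) ≤ 3 / (4 * (m : ℝ) ^ 2) := by
    rw [Real.sqrt_le_left (by positivity), div_pow, div_le_div_iff₀ (by positivity) (by positivity)]
    have := le_zeroFreqCount hm
    nlinarith [mul_le_mul_of_nonneg_left this hm'.le]
  calc _ ≤ 3 / (4 * (m : ℝ) ^ 2) * (4 * (m : ℝ) ^ 2) :=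
        mul_le_mul_of_nonneg_right h2 (by positivity)
    _ = 3 := by field_simp

/-- In the variable `θ = arccos t` only the zero frequency contributes to `∫ P_j(cos θ) dθ`, and the
Jacobian `sin θ` is at most `1`. -/
lemma integral_jacksonPoly_le {m : ℕ} (hm : 0 < m) (j : Fin (2 * m)) :
    ∫ t in (-1 : ℝ)..1, (jacksonPoly m j).eval t ≤ Real.pi / (2 * m) := by
  set P := jacksonPoly m j with hP
  have hsub : ∫ t in (-1 : ℝ)..1, P.eval t =
      ∫ θ in (0 : ℝ)..Real.pi, P.eval (Real.cos θ) * Real.sin θ := by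
    have := intervalIntegral.integral_comp_mul_deriv (a := 0) (b := Real.pi) (f := Real.cos)
      (f' := fun x => -Real.sin x) (g := fun t => P.eval t)
      (fun x _ => Real.hasDerivAt_cos x) (by fun_prop) (by fun_prop)
    simp only [Function.comp_def, Real.cos_zero, Real.cos_pi, mul_neg,
      intervalIntegral.integral_neg] at this
    rw [intervalIntegral.integral_symm, ← this, neg_neg]
  have hle : ∫ θ in (0 : ℝ)..Real.pi, P.eval (Real.cos θ) * Real.sin θ ≤
      ∫ θ in (0 : ℝ)..Real.pi, P.eval (Real.cos θ) := by
    refine intervalIntegral.integral_mono_on Real.pi_pos.le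
      (Continuous.intervalIntegrable (by fun_prop) _ _)
      (Continuous.intervalIntegrable (by fun_prop) _ _) fun θ _ => ?_
    exact mul_le_of_le_one_right
      (eval_jacksonPoly_nonneg m j ⟨Real.neg_one_le_cos θ, Real.cos_le_one θ⟩) (Real.sin_le_one θ)
  have hcos : ∀ n : ℤ, ∫ θ in (0 : ℝ)..Real.pi, Real.cos (n * θ) =
      if n = 0 then Real.pi else 0 := by
    intro n
    split_ifs with h
    · simp [h]
    · rw [intervalIntegral.integral_comp_mul_left (fun x => Real.cos x) (by exact_mod_cast h)]
      simp [integral_cos, Real.sin_int_mul_pi]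
  have heq : ∫ θ in (0 : ℝ)..Real.pi, P.eval (Real.cos θ) = Real.pi / (2 * m) := by
    simp_rw [hP, eval_jacksonPoly]
    rw [intervalIntegral.integral_const_mul, intervalIntegral.integral_finsetSum
      (fun q _ => Continuous.intervalIntegrable (by fun_prop) _ _)]
    simp_rw [intervalIntegral.integral_const_mul, hcos, mul_ite, mul_zero]
    rw [← Finset.sum_filter]
    have : ∀ q ∈ Finset.univ.filter
        (fun q : (Fin m × Fin m) × (Fin m × Fin m) => freq q = 0),
        Real.cos (freq q * (Real.pi * j / m)) * Real.pi = Real.pi := by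
      intro q hq
      simp [(Finset.mem_filter.1 hq).2]
    rw [Finset.sum_congr rfl this, Finset.sum_const, nsmul_eq_mul, ← zeroFreqCount]
    have := zeroFreqCount_pos hm
    have : (0 : ℝ) < m := by positivity
    field_simp
  rw [hsub]
  exact hle.trans heq.le

/-- A partition of unity on `[-R, R]` by `2 m` polynomials of degree at most `2 m - 2`, each
concentrated at scale `R / m`. -/
structure IsPolyPartition (R : ℝ) (m : ℕ) (P : Fin (2 * m) → ℝ[X]) : Prop where
  natDegree_le : ∀ j, (P j).natDegree ≤ 2 * m - 2
  nonneg : ∀ j, ∀ t ∈ Set.Icc (-R) R, 0 ≤ (P j).eval t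
  sum_eq : ∀ t ∈ Set.Icc (-R) R, ∑ j, (P j).eval t = 1
  sum_sqrt_le : ∀ t ∈ Set.Icc (-R) R, ∑ j, Real.sqrt ((P j).eval t) ≤ 3
  integral_le : ∀ j, ∫ t in (-R)..R, (P j).eval t ≤ Real.pi * R / (2 * m)

lemma exists_isPolyPartition {R : ℝ} (hR : 0 < R) {m : ℕ} (hm : 0 < m) :
    ∃ P, IsPolyPartition R m P := by
  have key : ∀ t ∈ Set.Icc (-R) R, R⁻¹ * t ∈ Set.Icc (-1 : ℝ) 1 := by
    intro t ht
    rw [inv_mul_eq_div]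
    constructor
    · rw [le_div_iff₀ hR]; linarith [ht.1]
    · rw [div_le_one hR]; exact ht.2
  have hev : ∀ j t, ((jacksonPoly m j).comp (C R⁻¹ * X)).eval t =
      (jacksonPoly m j).eval (R⁻¹ * t) := by
    intro j t
    simp
  refine ⟨fun j => (jacksonPoly m j).comp (C R⁻¹ * X), ?_, ?_, ?_, ?_, ?_⟩
  · intro j
    refine natDegree_comp_le.trans ?_
    rw [natDegree_C_mul_X _ (inv_ne_zero hR.ne'), mul_one]
    exact natDegree_jacksonPoly_le hm j
  · intro j t ht
    rw [hev]
    exact eval_jacksonPoly_nonneg m j (key t ht)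
  · intro t ht
    simp_rw [hev]
    exact sum_jacksonPoly hm (key t ht)
  · intro t ht
    simp_rw [hev]
    exact sum_sqrt_jacksonPoly hm (key t ht)
  · intro j
    simp_rw [hev]
    rw [intervalIntegral.integral_comp_mul_left (fun x => (jacksonPoly m j).eval x)
      (inv_ne_zero hR.ne')]
    have e1 : R⁻¹ * -R = -1 := by field_simp
    have e2 : R⁻¹ * R = 1 := by field_simp
    rw [e1, e2, inv_inv, smul_eq_mul]
    calc _ ≤ R * (Real.pi / (2 * m)) :=
          mul_le_mul_of_nonneg_left (integral_jacksonPoly_le hm j) hR.le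
      _ = _ := by ring

/-! ### Locality of the moments -/

lemma adjOp_single {U : Type*} (H : SimpleGraph U) (x : U) (c : ℂ) :
    adjOp H (Finsupp.single x c) = c • ∑ᶠ y ∈ H.neighborSet x, Finsupp.single y (1 : ℂ) := by
  simp [adjOp]

/-- `⟨e_x, A ^ i e_x⟩` for the adjacency operator `A` of `H`. -/
def vertexMoment {U : Type*} (H : SimpleGraph U) (x : U) (i : ℕ) : ℂ :=
  (adjOp H ^ i) (Finsupp.single x 1) x

/-- `⟨e_x, P(A) e_x⟩` for the adjacency operator `A` of `H`. -/
def polyMoment {U : Type*} (H : SimpleGraph U) (x : U) (P : ℝ[X]) : ℝ :=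
  P.sum fun i c => c * (vertexMoment H x i).re

/-- If an induced subgraph contains the ball of radius `h` around a vertex, the iterates
`A ^ i e_x`, `i ≤ h`, may be computed in the subgraph. -/
lemma adjOp_pow_embedding {W V : Type*} {K : SimpleGraph W} {H : SimpleGraph V} (e : K ↪g H)
    (x : W) (h : ℕ) (hfin : ∀ v, (H.neighborSet v).Finite)
    (hball : ∀ u, H.edist (e x) u ≤ (h : ℕ∞) → u ∈ Set.range e) (i : ℕ) (hi : i ≤ h) :
    (adjOp H ^ i) (Finsupp.single (e x) 1) =
        Finsupp.lmapDomain ℂ ℂ e ((adjOp K ^ i) (Finsupp.single x 1)) ∧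
      ∀ y ∈ ((adjOp K ^ i) (Finsupp.single x 1)).support, H.edist (e x) (e y) ≤ (i : ℕ∞) := by
  classical
  induction i with
  | zero =>
    refine ⟨by simp, fun y hy => ?_⟩
    have : y = x := by simpa using hy
    simp [this]
  | succ i ih =>
    obtain ⟨ih1, ih2⟩ := ih (by omega)
    set w := (adjOp K ^ i) (Finsupp.single x 1) with hw
    have hstep : ∀ y, H.edist (e x) (e y) ≤ (i : ℕ∞) → ∀ z, H.Adj (e y) z →
        H.edist (e x) z ≤ ((i + 1 : ℕ) : ℕ∞) := by
      intro y hy z hz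
      have h1 : H.edist (e x) z ≤ H.edist (e x) (e y) + H.edist (e y) z :=
        SimpleGraph.edist_triangle ..
      refine h1.trans ?_
      push_cast
      exact add_le_add hy (SimpleGraph.edist_le_one_iff_adj_or_eq.2 (Or.inl hz))
    have hnb : ∀ y ∈ w.support, H.neighborSet (e y) = e '' K.neighborSet y := by
      intro y hy
      ext z
      constructor
      · intro hz
        obtain ⟨z', rfl⟩ := hball z
          ((hstep y (ih2 y hy) z hz).trans (by exact_mod_cast hi))
        exact ⟨z', e.map_adj_iff.1 hz, rfl⟩
      · rintro ⟨z', hz', rfl⟩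
        exact e.map_adj_iff.2 hz'
    have hKfin : ∀ y, (K.neighborSet y).Finite := fun y =>
      ((hfin (e y)).preimage e.injective.injOn).subset fun z hz => e.map_adj_iff.2 hz
    have hsing : ∀ y ∈ w.support, ∀ c : ℂ, adjOp H (Finsupp.single (e y) c) =
        Finsupp.lmapDomain ℂ ℂ e (adjOp K (Finsupp.single y c)) := by
      intro y hy c
      rw [adjOp_single, adjOp_single, map_smul, hnb y hy,
        finsum_mem_image e.injective.injOn, ← AddMonoidHom.coe_coe (Finsupp.lmapDomain ℂ ℂ e)]
      congr 1
      rw [AddMonoidHom.map_finsum_mem _ _ (hKfin y)]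
      simp
    constructor
    · rw [pow_succ', pow_succ', Module.End.mul_apply, Module.End.mul_apply, ih1, ← hw]
      conv_lhs => rw [← Finsupp.sum_single w]
      conv_rhs => rw [← Finsupp.sum_single w]
      simp only [Finsupp.sum, map_sum, Finsupp.lmapDomain_apply, Finsupp.mapDomain_single]
      exact Finset.sum_congr rfl fun y hy => hsing y hy _
    · intro z hz
      rw [pow_succ', Module.End.mul_apply, ← hw, ← Finsupp.sum_single w] at hz
      simp only [Finsupp.sum, map_sum] at hz
      obtain ⟨y, hy, hyz⟩ := Finset.mem_biUnion.1 (Finsupp.support_finsetSum hz)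
      have hadj : K.Adj y z := by
        by_contra hn
        refine (Finsupp.mem_support_iff.1 hyz) ?_
        rw [adjOp_single, Finsupp.smul_apply, finsum_mem_eq_finite_toFinset_sum _ (hKfin y),
          Finsupp.finsetSum_apply, Finset.sum_eq_zero, smul_zero]
        intro u hu
        rw [Finsupp.single_apply, if_neg]
        rintro rfl
        exact hn ((hKfin y).mem_toFinset.1 hu)
      exact hstep y (ih2 y hy) _ (e.map_adj_iff.2 hadj)

lemma vertexMoment_embedding {W V : Type*} {K : SimpleGraph W} {H : SimpleGraph V} (e : K ↪g H)
    (x : W) (h : ℕ) (hfin : ∀ v, (H.neighborSet v).Finite)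
    (hball : ∀ u, H.edist (e x) u ≤ (h : ℕ∞) → u ∈ Set.range e) (i : ℕ) (hi : i ≤ h) :
    vertexMoment H (e x) i = vertexMoment K x i := by
  rw [vertexMoment, (adjOp_pow_embedding e x h hfin hball i hi).1, Finsupp.lmapDomain_apply,
    Finsupp.mapDomain_apply e.injective, vertexMoment]

lemma polyMoment_embedding {W V : Type*} {K : SimpleGraph W} {H : SimpleGraph V} (e : K ↪g H)
    (x : W) (h : ℕ) (hfin : ∀ v, (H.neighborSet v).Finite)
    (hball : ∀ u, H.edist (e x) u ≤ (h : ℕ∞) → u ∈ Set.range e) {P : ℝ[X]}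
    (hP : P.natDegree ≤ h) :
    polyMoment H (e x) P = polyMoment K x P := by
  refine Finset.sum_congr rfl fun i hi => ?_
  dsimp only
  rw [vertexMoment_embedding e x h hfin hball i ((le_natDegree_of_mem_supp i hi).trans hP)]

/-! ### Spectral decomposition of finite graphs -/

section Finite

variable {V : Type*} [Fintype V]

lemma adjOp_eq_mulVec [DecidableEq V] (H : SimpleGraph V) [DecidableRel H.Adj] (v : V →₀ ℂ) :
    ⇑(adjOp H v) = (H.adjMatrix ℂ).mulVec ⇑v := by
  induction v using Finsupp.induction_linear with
  | zero => simp
  | add f g hf hg => rw [map_add, Finsupp.coe_add, hf, hg, Finsupp.coe_add, Matrix.mulVec_add]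
  | single x c =>
    ext y
    rw [adjOp_single, Finsupp.smul_apply,
      finsum_mem_eq_finite_toFinset_sum _ (Set.toFinite _), Finsupp.finsetSum_apply,
      Finsupp.single_eq_pi_single, Matrix.mulVec_single]
    simp only [Finsupp.single_apply, Finset.sum_ite_eq', Set.Finite.mem_toFinset,
      SimpleGraph.mem_neighborSet, smul_eq_mul, Pi.smul_apply, Matrix.col_apply,
      SimpleGraph.adjMatrix_apply, H.adj_comm x y]
    simp

open Classical in
/-- `ψ` consists of eigenvectors of the adjacency matrix of `H`, with real eigenvalues `lam`. -/
def HasEigenvalues {ι : Type*} [Fintype ι] (H : SimpleGraph V)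
    (ψ : OrthonormalBasis ι ℂ (EuclideanSpace ℂ V)) (lam : ι → ℝ) : Prop :=
  ∀ k, (H.adjMatrix ℂ).mulVec (ψ k).ofLp = (lam k : ℂ) • (ψ k).ofLp

lemma vertexMoment_eq_sum {ι : Type*} [Fintype ι] {H : SimpleGraph V}
    {ψ : OrthonormalBasis ι ℂ (EuclideanSpace ℂ V)} {lam : ι → ℝ} (hψ : HasEigenvalues H ψ lam)
    (x : V) (i : ℕ) :
    vertexMoment H x i = ((∑ k, lam k ^ i * ‖ψ k x‖ ^ 2 : ℝ) : ℂ) := by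
  classical
  have h0 : (Pi.single x 1 : V → ℂ) = ∑ k, (starRingEnd ℂ (ψ k x)) • (ψ k).ofLp := by
    have := ψ.sum_repr' (EuclideanSpace.single x (1 : ℂ))
    have h2 := congrArg WithLp.ofLp this
    simp only [EuclideanSpace.inner_single_right, one_mul, WithLp.ofLp_sum, WithLp.ofLp_smul] at h2
    rw [h2]
    rfl
  have h1 : ∀ i : ℕ, ⇑((adjOp H ^ i) (Finsupp.single x 1)) =
      ∑ k, ((lam k : ℂ) ^ i * starRingEnd ℂ (ψ k x)) • (ψ k).ofLp := by
    intro i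
    induction i with
    | zero =>
      rw [pow_zero, Module.End.one_apply, Finsupp.single_eq_pi_single, h0]
      simp
    | succ i ih =>
      rw [pow_succ', Module.End.mul_apply, adjOp_eq_mulVec, ih, Matrix.mulVec_sum]
      refine Finset.sum_congr rfl fun k _ => ?_
      rw [Matrix.mulVec_smul]
      have := hψ k
      convert congrArg (((lam k : ℂ) ^ i * starRingEnd ℂ (ψ k x)) • ·) this using 1
      rw [smul_smul]
      congr 1
      ring
  rw [vertexMoment, h1]
  push_cast
  simp only [Finset.sum_apply, Pi.smul_apply, smul_eq_mul]
  refine Finset.sum_congr rfl fun k _ => ?_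
  rw [mul_assoc, ← Complex.normSq_eq_conj_mul_self, Complex.normSq_eq_norm_sq]
  push_cast
  rfl

lemma polyMoment_eq_sum {ι : Type*} [Fintype ι] {H : SimpleGraph V}
    {ψ : OrthonormalBasis ι ℂ (EuclideanSpace ℂ V)} {lam : ι → ℝ} (hψ : HasEigenvalues H ψ lam)
    (x : V) (P : ℝ[X]) :
    polyMoment H x P = ∑ k, P.eval (lam k) * ‖ψ k x‖ ^ 2 := by
  simp only [polyMoment, vertexMoment_eq_sum hψ, Complex.ofReal_re, eval_eq_sum, Polynomial.sum,
    Finset.mul_sum, Finset.sum_mul]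
  rw [Finset.sum_comm]
  simp only [mul_assoc]

lemma sum_norm_sq_apply {ι : Type*} [Fintype ι] (ψ : OrthonormalBasis ι ℂ (EuclideanSpace ℂ V))
    (x : V) : ∑ k, ‖ψ k x‖ ^ 2 = 1 := by
  classical
  have := ψ.sum_sq_norm_inner_right (EuclideanSpace.single x (1 : ℂ))
  simpa [EuclideanSpace.inner_single_right] using this

lemma sum_norm_sq_coord {ι : Type*} [Fintype ι] (ψ : OrthonormalBasis ι ℂ (EuclideanSpace ℂ V))
    (k : ι) : ∑ x, ‖ψ k x‖ ^ 2 = 1 := by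
  rw [← EuclideanSpace.norm_sq_eq, ψ.norm_eq_one, one_pow]

lemma abs_eigenvalue_le {ι : Type*} [Fintype ι] {H : SimpleGraph V}
    {ψ : OrthonormalBasis ι ℂ (EuclideanSpace ℂ V)} {lam : ι → ℝ} (hψ : HasEigenvalues H ψ lam)
    {D : ℕ} (hD : ∀ v, (H.neighborSet v).encard ≤ D) (k : ι) : |lam k| ≤ D := by
  classical
  have hne : ∃ x, ψ k x ≠ 0 := by
    by_contra! h
    have := sum_norm_sq_coord ψ k
    simp [h] at this
  obtain ⟨x₀, hx₀⟩ := hne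
  have : Nonempty V := ⟨x₀⟩
  obtain ⟨y, hy⟩ := Finite.exists_max fun x => ‖ψ k x‖
  have hpos : 0 < ‖ψ k y‖ := (norm_pos_iff.2 hx₀).trans_le (hy x₀)
  have h1 := congrFun (hψ k) y
  have hcard : ((H.neighborFinset y).card : ℝ) ≤ D := by
    have := hD y
    rw [← SimpleGraph.coe_neighborFinset, Set.encard_coe_eq_coe_finsetCard] at this
    exact_mod_cast this
  have h2 : ∑ z ∈ H.neighborFinset y, ψ k z = (lam k : ℂ) * ψ k y := by
    rw [← smul_eq_mul]
    have h3 := h1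
    rw [SimpleGraph.adjMatrix_mulVec_apply] at h3
    exact h3
  have h3 : |lam k| * ‖ψ k y‖ ≤ D * ‖ψ k y‖ := by
    calc |lam k| * ‖ψ k y‖ = ‖∑ z ∈ H.neighborFinset y, ψ k z‖ := by
          rw [h2, norm_mul, Complex.norm_real, Real.norm_eq_abs]
      _ ≤ ∑ z ∈ H.neighborFinset y, ‖ψ k z‖ := norm_sum_le _ _
      _ ≤ ∑ z ∈ H.neighborFinset y, ‖ψ k y‖ := Finset.sum_le_sum fun z _ => hy z
      _ = (H.neighborFinset y).card * ‖ψ k y‖ := by rw [Finset.sum_const, nsmul_eq_mul]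
      _ ≤ D * ‖ψ k y‖ := mul_le_mul_of_nonneg_right hcard hpos.le
  exact le_of_mul_le_mul_right h3 hpos

omit [Fintype V] in
lemma isHermitian_adjMatrix (H : SimpleGraph V) [DecidableRel H.Adj] :
    (H.adjMatrix ℂ).IsHermitian := by
  ext i j
  simp [Matrix.conjTranspose_apply, SimpleGraph.adjMatrix_apply, H.adj_comm, apply_ite]

lemma IsEigenbasis.exists_hasEigenvalues {H : SimpleGraph V}
    {ψ : OrthonormalBasis (Fin (Fintype.card V)) ℂ (EuclideanSpace ℂ V)}
    (hψ : IsEigenbasis H ψ) : ∃ lam, HasEigenvalues H ψ lam := by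
  classical
  choose lam hlam using hψ
  refine ⟨fun k => (lam k).re, fun k => ?_⟩
  have hsymm := Matrix.isSymmetric_toEuclideanLin_iff.2 (isHermitian_adjMatrix H)
  have heig : Matrix.toEuclideanLin (H.adjMatrix ℂ) (ψ k) = lam k • ψ k := by
    apply WithLp.ofLp_injective 2
    exact hlam k
  have hne : ψ k ≠ 0 := ψ.orthonormal.ne_zero k
  have hreal := hsymm.conj_eigenvalue_eq_self
    (Module.End.hasEigenvalue_of_hasEigenvector
      (Module.End.hasEigenvector_iff.2 ⟨Module.End.mem_eigenspace_iff.2 heig, hne⟩))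
  rw [Complex.conj_eq_iff_re.1 hreal]
  exact hlam k

lemma exists_hasEigenvalues (H : SimpleGraph V) :
    ∃ (ψ : OrthonormalBasis V ℂ (EuclideanSpace ℂ V)) (lam : V → ℝ), HasEigenvalues H ψ lam := by
  classical
  refine ⟨(isHermitian_adjMatrix H).eigenvectorBasis, (isHermitian_adjMatrix H).eigenvalues,
    fun k => ?_⟩
  have := (isHermitian_adjMatrix H).mulVec_eigenvectorBasis k
  rw [this]
  ext y
  simp

end Finite

/-! ### Restriction of percolation to induced subgraphs -/

lemma percGraph_le {V : Type*} (G : SimpleGraph V) (ω : G.edgeSet → Bool) : percGraph G ω ≤ G :=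
  fun _ _ h => h.1

/-- The map induced on edges by an embedding of graphs. -/
def edgeMap {W V : Type*} {K : SimpleGraph W} {G : SimpleGraph V} (e : K ↪g G) :
    K.edgeSet → G.edgeSet := e.mapEdgeSet

lemma edgeMap_injective {W V : Type*} {K : SimpleGraph W} {G : SimpleGraph V} (e : K ↪g G) :
    Function.Injective (edgeMap e) := e.mapEdgeSet.injective

/-- An embedding of graphs is also an embedding of the percolated graphs, for the restricted
configuration. -/
def percEmbedding {W V : Type*} {K : SimpleGraph W} {G : SimpleGraph V} (e : K ↪g G)
    (ω : G.edgeSet → Bool) : percGraph K (ω ∘ edgeMap e) ↪g percGraph G ω where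
  toEmbedding := e.toEmbedding
  map_rel_iff' := by
    intro x y
    constructor
    · rintro ⟨h, hω⟩
      exact ⟨e.map_adj_iff.1 h, hω⟩
    · rintro ⟨h, hω⟩
      exact ⟨e.map_adj_iff.2 h, hω⟩

/-- Polynomial moments of degree at most `h` on a percolated graph may be computed on any induced
subgraph containing the ball of radius `h` of the original graph. -/
lemma polyMoment_percGraph_embedding {W V : Type*} {K : SimpleGraph W} {G : SimpleGraph V}
    (e : K ↪g G) (x : W) (h : ℕ) (hfin : ∀ v, (G.neighborSet v).Finite)
    (hball : ballSet G (e x) h ⊆ Set.range e) {P : ℝ[X]} (hP : P.natDegree ≤ h)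
    (ω : G.edgeSet → Bool) :
    polyMoment (percGraph G ω) (e x) P = polyMoment (percGraph K (ω ∘ edgeMap e)) x P := by
  refine polyMoment_embedding (percEmbedding e ω) x h (fun v => (hfin v).subset ?_) ?_ hP
  · exact fun z hz => hz.1
  · intro u hu
    exact hball ((SimpleGraph.edist_anti (percGraph_le G ω)).trans hu)

/-- Percolation on `G` restricted to an induced subgraph is percolation on the subgraph. -/
lemma measurePreserving_comp_edgeMap {W V : Type*} {K : SimpleGraph W} {G : SimpleGraph V}
    (e : K ↪g G) (p : unitInterval) :
    MeasurePreserving (fun ω : G.edgeSet → Bool => ω ∘ edgeMap e) (edgeLaw G p) (edgeLaw K p) := by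
  classical
  have hmeas : Measurable (fun ω : G.edgeSet → Bool => ω ∘ edgeMap e) := by
    rw [measurable_pi_iff]
    exact fun a => measurable_pi_apply _
  refine ⟨hmeas, ?_⟩
  refine Measure.eq_infinitePi _ fun s t ht => ?_
  rw [Measure.map_apply hmeas (MeasurableSet.pi s.countable_toSet fun i _ => ht i)]
  have : (fun ω : G.edgeSet → Bool => ω ∘ edgeMap e) ⁻¹' Set.pi s t =
      Set.pi (s.map ⟨edgeMap e, edgeMap_injective e⟩ : Finset G.edgeSet)
        (Function.extend (edgeMap e) t fun _ => Set.univ) := by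
    ext ω
    simp only [Set.mem_preimage, Set.mem_pi, Finset.mem_coe, Finset.mem_map,
      Function.Embedding.coeFn_mk, forall_exists_index, and_imp, forall_apply_eq_imp_iff₂,
      (edgeMap_injective e).extend_apply, Function.comp_apply]
  rw [this, edgeLaw, Measure.infinitePi_pi]
  · rw [Finset.prod_map]
    simp [(edgeMap_injective e).extend_apply]
  · exact fun _ _ => MeasurableSet.of_discrete

/-! ### The bounded differences inequality -/

/-- Resampling one coordinate preserves the product measure. -/
lemma measurePreserving_update {ι : Type*} [DecidableEq ι] (ν : Measure Bool)
    [IsProbabilityMeasure ν] (e : ι) :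
    MeasurePreserving (fun z : (ι → Bool) × Bool => Function.update z.1 e z.2)
      ((Measure.infinitePi fun _ : ι => ν).prod ν) (Measure.infinitePi fun _ : ι => ν) := by
  have hmeas : Measurable (fun z : (ι → Bool) × Bool => Function.update z.1 e z.2) := by
    rw [measurable_pi_iff]
    intro a
    by_cases h : a = e
    · subst h
      simpa using measurable_snd
    · simp only [Function.update_of_ne h]
      exact (measurable_pi_apply a).comp measurable_fst
  refine ⟨hmeas, Measure.eq_infinitePi _ fun s t ht => ?_⟩
  rw [Measure.map_apply hmeas (MeasurableSet.pi s.countable_toSet fun i _ => ht i)]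
  have : (fun z : (ι → Bool) × Bool => Function.update z.1 e z.2) ⁻¹' Set.pi s t =
      Set.pi (s.erase e : Finset ι) t ×ˢ (if e ∈ s then t e else Set.univ) := by
    ext z
    simp only [Set.mem_preimage, Set.mem_pi, Finset.mem_coe, Set.mem_prod, Finset.mem_erase]
    constructor
    · intro h
      refine ⟨fun i hi => by simpa [Function.update_of_ne hi.1] using h i hi.2, ?_⟩
      split_ifs with he
      · simpa using h e he
      · trivial
    · rintro ⟨h1, h2⟩ i hi
      by_cases hie : i = e
      · subst hie
        simpa [hi] using h2
      · simpa [Function.update_of_ne hie] using h1 i ⟨hie, hi⟩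
  rw [this, Measure.prod_prod, Measure.infinitePi_pi _ fun i _ => ht i]
  split_ifs with he
  · rw [Finset.prod_erase_mul s (fun i => ν (t i)) he]
  · rw [Finset.erase_eq_of_notMem he, measure_univ, mul_one]

/-- Exponential moment bound behind the bounded differences inequality: the coordinates on which
`F` depends are integrated out one at a time. -/
lemma integral_exp_le_of_bounded_differences {ι : Type*} [Finite ι] [DecidableEq ι]
    (ν : Measure Bool) [IsProbabilityMeasure ν] (c : ι → ℝ) (s : ℝ) (T : Finset ι) :
    ∀ F : (ι → Bool) → ℝ, (∀ ω e b, e ∉ T → F (Function.update ω e b) = F ω) →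
      (∀ ω e b, |F (Function.update ω e b) - F ω| ≤ c e) →
      ∫ ω, Real.exp (s * F ω) ∂(Measure.infinitePi fun _ : ι => ν) ≤
        Real.exp (s * (∫ ω, F ω ∂(Measure.infinitePi fun _ : ι => ν)) +
          s ^ 2 * (∑ e ∈ T, c e ^ 2) / 2) := by
  set P := Measure.infinitePi fun _ : ι => ν with hP
  induction T using Finset.induction_on with
  | empty =>
    intro F hF _
    have hconst : ∀ ω, F ω = F fun _ => false := by
      intro ω
      have hS : ∀ S : Finset ι, F ω = F fun i => if i ∈ S then false else ω i := by
        intro S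
        induction S using Finset.induction_on with
        | empty => simp
        | insert e S he ih =>
          rw [ih, ← hF (fun i => if i ∈ S then false else ω i) e false (by simp)]
          congr 1
          ext i
          by_cases hi : i = e
          · subst hi; simp
          · simp [hi]
      have := Fintype.ofFinite ι
      simpa using hS Finset.univ
    simp_rw [hconst]
    simp
  | insert e T he ih =>
    intro F hF hc
    have hprod : ∀ g : (ι → Bool) → ℝ,
        ∫ ω, g ω ∂P = ∫ ω, ∫ b, g (Function.update ω e b) ∂ν ∂P := by
      intro g
      have hmp := measurePreserving_update ν e
      rw [← hP] at hmp
      rw [← hmp.map_eq, integral_map hmp.measurable.aemeasurable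
        (StronglyMeasurable.of_discrete).aestronglyMeasurable, hmp.map_eq,
        integral_prod _ Integrable.of_finite]
    set F' : (ι → Bool) → ℝ := fun ω => ∫ b, F (Function.update ω e b) ∂ν with hF'
    have hdiff : ∀ ω, ∫ b, Real.exp (s * F (Function.update ω e b)) ∂ν ≤
        Real.exp (s * F' ω) * Real.exp (s ^ 2 * c e ^ 2 / 2) := by
      intro ω
      -- The interval around `F ω` has length `2 c e`; this is where the optimal constant is lost.
      have hH := hasSubgaussianMGF_of_mem_Icc (μ := ν)
        (X := fun b => F (Function.update ω e b)) (a := F ω - c e) (b := F ω + c e)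
        (Measurable.of_discrete).aemeasurable
        (Filter.Eventually.of_forall fun b => by
          have := abs_le.1 (hc ω e b)
          constructor <;> linarith [this.1, this.2])
      have h2 := hH.mgf_le s
      have hce : 0 ≤ c e := (abs_nonneg _).trans (hc ω e true)
      rw [mgf] at h2
      have h3 : ∀ b, Real.exp (s * F (Function.update ω e b)) = Real.exp (s * F' ω) *
          Real.exp (s * (F (Function.update ω e b) - ∫ b, F (Function.update ω e b) ∂ν)) := by
        intro b
        rw [← Real.exp_add]
        congr 1
        simp only [hF']
        ring
      simp_rw [h3]
      rw [integral_const_mul]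
      refine mul_le_mul_of_nonneg_left (h2.trans (Real.exp_le_exp.2 ?_)) (Real.exp_pos _).le
      have : ((‖F ω + c e - (F ω - c e)‖₊ / 2) ^ 2 : NNReal) = (c e ^ 2 : ℝ) := by
        push_cast
        rw [show F ω + c e - (F ω - c e) = 2 * c e by ring, Real.norm_eq_abs,
          abs_of_nonneg (by positivity)]
        ring
      rw [this]
      apply le_of_eq
      ring
    have hF'dep : ∀ ω e' b, e' ∉ T → F' (Function.update ω e' b) = F' ω := by
      intro ω e' b he'
      refine integral_congr_ae (Filter.Eventually.of_forall fun b' => ?_)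
      dsimp only
      by_cases hee : e' = e
      · subst hee; simp
      · rw [Function.update_comm hee, hF _ e' b (by simp [hee, he'])]
    have hF'c : ∀ ω e' b, |F' (Function.update ω e' b) - F' ω| ≤ c e' := by
      intro ω e' b
      simp only [hF']
      rw [← integral_sub Integrable.of_finite Integrable.of_finite]
      by_cases hee : e' = e
      · subst hee
        simpa using (abs_nonneg _).trans (hc ω e' true)
      · have := norm_integral_le_of_norm_le_const (μ := ν) (C := c e')
          (f := fun b' => F (Function.update (Function.update ω e' b) e b') -
            F (Function.update ω e b'))
          (Filter.Eventually.of_forall fun b' => by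
            rw [Function.update_comm hee]
            exact hc _ e' b)
        rwa [probReal_univ, mul_one, Real.norm_eq_abs] at this
    rw [hprod]
    calc ∫ ω, ∫ b, Real.exp (s * F (Function.update ω e b)) ∂ν ∂P
        ≤ ∫ ω, Real.exp (s * F' ω) * Real.exp (s ^ 2 * c e ^ 2 / 2) ∂P :=
          integral_mono Integrable.of_finite Integrable.of_finite hdiff
      _ = (∫ ω, Real.exp (s * F' ω) ∂P) * Real.exp (s ^ 2 * c e ^ 2 / 2) :=
          integral_mul_const _ _
      _ ≤ Real.exp (s * (∫ ω, F' ω ∂P) + s ^ 2 * (∑ e ∈ T, c e ^ 2) / 2) *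
            Real.exp (s ^ 2 * c e ^ 2 / 2) :=
          mul_le_mul_of_nonneg_right (ih F' hF'dep hF'c) (Real.exp_pos _).le
      _ = _ := by
          rw [← Real.exp_add, hprod F, Finset.sum_insert he]
          congr 1
          ring

/-- McDiarmid's bounded differences inequality for independent Boolean variables (with a
non-optimal constant). -/
lemma measure_ge_le_of_bounded_differences {ι : Type*} [Fintype ι] [DecidableEq ι]
    (ν : Measure Bool) [IsProbabilityMeasure ν] (c : ι → ℝ) (F : (ι → Bool) → ℝ)
    (hc : ∀ ω e b, |F (Function.update ω e b) - F ω| ≤ c e) {t S : ℝ} (ht : 0 ≤ t) (hS : 0 < S)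
    (hcS : ∑ e, c e ^ 2 ≤ S) :
    (Measure.infinitePi fun _ : ι => ν).real
        {ω | (∫ ω, F ω ∂(Measure.infinitePi fun _ : ι => ν)) + t ≤ F ω} ≤
      Real.exp (-(t ^ 2 / (2 * S))) := by
  set P := Measure.infinitePi fun _ : ι => ν with hP
  have h1 := measure_ge_le_exp_mul_mgf (μ := P) (X := F) ((∫ ω, F ω ∂P) + t) (t := t / S)
    (by positivity) Integrable.of_finite
  refine h1.trans ?_
  have h2 := integral_exp_le_of_bounded_differences ν c (t / S) Finset.univ F (by simp) hc
  rw [← hP] at h2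
  refine (mul_le_mul_of_nonneg_left h2 (Real.exp_pos _).le).trans ?_
  rw [← Real.exp_add, Real.exp_le_exp]
  have h3 : (t / S) ^ 2 * (∑ e, c e ^ 2) / 2 ≤ (t / S) ^ 2 * S / 2 := by gcongr
  have h4 : (t / S) ^ 2 * S / 2 = t ^ 2 / (2 * S) := by field_simp
  have h5 : t / S * t = 2 * (t ^ 2 / (2 * S)) := by field_simp
  nlinarith

/-! ### Existence and measurability of spectral measures -/

lemma finite_ballSet {V : Type*} {G : SimpleGraph V} (hfin : ∀ v, (G.neighborSet v).Finite)
    (v : V) (h : ℕ) : (ballSet G v h).Finite := by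
  have key : ∀ h : ℕ, ∀ v, {u | ∃ q : G.Walk v u, q.length ≤ h}.Finite := by
    intro h
    induction h with
    | zero =>
      intro v
      refine (Set.finite_singleton v).subset ?_
      rintro u ⟨q, hq⟩
      exact (SimpleGraph.Walk.eq_of_length_eq_zero (Nat.le_zero.1 hq)).symm
    | succ h ih =>
      intro v
      refine (((hfin v).biUnion fun w _ => ih w).union (Set.finite_singleton v)).subset ?_
      rintro u ⟨q, hq⟩
      cases q with
      | nil => exact Or.inr rfl
      | cons hadj q =>
        refine Or.inl (Set.mem_biUnion hadj ⟨q, ?_⟩)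
        simpa using hq
  refine (key h v).subset fun u hu => ?_
  have hu' : G.edist v u ≤ (h : ℕ∞) := hu
  obtain ⟨q, hq⟩ := SimpleGraph.exists_walk_of_edist_ne_top
    (ne_top_of_le_ne_top (ENat.natCast_ne_top h) hu')
  refine ⟨q, ?_⟩
  rw [← hq] at hu'
  exact_mod_cast hu'

lemma finite_neighborSet_of_encard_le {V : Type*} {H : SimpleGraph V} {D : ℕ}
    (hD : ∀ v, (H.neighborSet v).encard ≤ D) (v : V) : (H.neighborSet v).Finite :=
  Set.finite_of_encard_le_coe (hD v)

lemma mem_ballSet_self {V : Type*} (G : SimpleGraph V) (v : V) (h : ℕ) : v ∈ ballSet G v h := by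
  simp [ballSet]

/-- The spectral measure of a finite graph at a vertex: atoms at the eigenvalues, weighted by the
squared entries of the eigenvectors. -/
lemma exists_probabilityMeasure_of_finite {V : Type*} [Finite V] (K : SimpleGraph V) {D : ℕ}
    (hD : ∀ v, (K.neighborSet v).encard ≤ D) (x : V) :
    ∃ ν : ProbabilityMeasure (Set.Icc (-(D : ℝ)) D), ∀ i : ℕ,
      ((∫ t, (t : ℝ) ^ i ∂(ν : Measure (Set.Icc (-(D : ℝ)) D)) : ℝ) : ℂ) = vertexMoment K x i := by
  have := Fintype.ofFinite V
  obtain ⟨ψ, lam, hψ⟩ := exists_hasEigenvalues K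
  have hlam : ∀ k, lam k ∈ Set.Icc (-(D : ℝ)) D := fun k => abs_le.1 (abs_eigenvalue_le hψ hD k)
  let ν : Measure (Set.Icc (-(D : ℝ)) D) :=
    ∑ k, ENNReal.ofReal (‖ψ k x‖ ^ 2) • Measure.dirac ⟨lam k, hlam k⟩
  have hν : IsProbabilityMeasure ν := by
    constructor
    simp only [ν, Measure.coe_finsetSum, Finset.sum_apply, Measure.smul_apply, measure_univ,
      smul_eq_mul, mul_one]
    rw [← ENNReal.ofReal_sum_of_nonneg fun _ _ => by positivity, sum_norm_sq_apply,
      ENNReal.ofReal_one]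
  refine ⟨⟨ν, hν⟩, fun i => ?_⟩
  rw [vertexMoment_eq_sum hψ]
  congr 1
  change ∫ t, (t : ℝ) ^ i ∂ν = _
  simp only [ν]
  rw [integral_finsetSum_measure]
  · refine Finset.sum_congr rfl fun k _ => ?_
    rw [integral_smul_measure, integral_dirac, ENNReal.toReal_ofReal (by positivity), smul_eq_mul,
      mul_comm]
  · intro k _
    refine Integrable.smul_measure ?_ ENNReal.ofReal_ne_top
    exact integrable_dirac (by simp)

/-- Existence of the spectral measure on `[-D, D]` for a graph with degrees at most `D`, as a weak
limit of the spectral measures of the balls around the vertex. -/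
lemma exists_probabilityMeasure {V : Type*} (H : SimpleGraph V) {D : ℕ}
    (hD : ∀ v, (H.neighborSet v).encard ≤ D) (x : V) :
    ∃ ν : ProbabilityMeasure (Set.Icc (-(D : ℝ)) D), ∀ i : ℕ,
      ((∫ t, (t : ℝ) ^ i ∂(ν : Measure (Set.Icc (-(D : ℝ)) D)) : ℝ) : ℂ) = vertexMoment H x i := by
  have hfin := finite_neighborSet_of_encard_le hD
  have hstep : ∀ h : ℕ, ∃ ν : ProbabilityMeasure (Set.Icc (-(D : ℝ)) D), ∀ i ≤ h,
      ((∫ t, (t : ℝ) ^ i ∂(ν : Measure (Set.Icc (-(D : ℝ)) D)) : ℝ) : ℂ) =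
        vertexMoment H x i := by
    intro h
    have := (finite_ballSet hfin x h).to_subtype
    let e : H.induce (ballSet H x h) ↪g H := SimpleGraph.Embedding.induce _
    have hD' : ∀ v, ((H.induce (ballSet H x h)).neighborSet v).encard ≤ D := by
      intro v
      rw [← e.injective.encard_image]
      refine (Set.encard_le_encard ?_).trans (hD (e v))
      rintro _ ⟨z, hz, rfl⟩
      exact e.map_adj_iff.2 hz
    obtain ⟨ν, hν⟩ := exists_probabilityMeasure_of_finite _ hD' ⟨x, mem_ballSet_self H x h⟩
    refine ⟨ν, fun i hi => ?_⟩
    rw [hν i]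
    exact (vertexMoment_embedding e ⟨x, mem_ballSet_self H x h⟩ h hfin
      (fun u hu => ⟨⟨u, hu⟩, rfl⟩) i hi).symm
  choose ν hν using hstep
  obtain ⟨ν₀, hν₀⟩ := exists_clusterPt_of_compactSpace (map ν atTop)
  obtain ⟨l, hl, hlim⟩ := mapClusterPt_iff_ultrafilter.1 hν₀
  refine ⟨ν₀, fun i => ?_⟩
  have h1 := (ProbabilityMeasure.tendsto_iff_forall_integral_tendsto.1 hlim)
    (BoundedContinuousFunction.mkOfCompact ⟨fun t : Set.Icc (-(D : ℝ)) D => (t : ℝ) ^ i,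
      by fun_prop⟩)
  have h2 : Tendsto (fun h => ((∫ t, (t : ℝ) ^ i ∂(ν h : Measure (Set.Icc (-(D : ℝ)) D)) : ℝ) : ℂ))
      l (𝓝 ((∫ t, (t : ℝ) ^ i ∂(ν₀ : Measure (Set.Icc (-(D : ℝ)) D)) : ℝ) : ℂ)) :=
    (Complex.continuous_ofReal.tendsto _).comp h1
  refine tendsto_nhds_unique h2 (tendsto_const_nhds.congr' ?_)
  filter_upwards [hl (eventually_ge_atTop i)] with h hh
  exact (hν h i hh).symm

lemma exists_isSpectralMeasure {V : Type*} (H : SimpleGraph V) {D : ℕ}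
    (hD : ∀ v, (H.neighborSet v).encard ≤ D) (x : V) : ∃ μ, IsSpectralMeasure H x μ := by
  obtain ⟨ν, hν⟩ := exists_probabilityMeasure H hD x
  have hme : MeasurableEmbedding (Subtype.val : Set.Icc (-(D : ℝ)) D → ℝ) :=
    MeasurableEmbedding.subtype_coe measurableSet_Icc
  refine ⟨(ν : Measure (Set.Icc (-(D : ℝ)) D)).map Subtype.val,
    Measure.isProbabilityMeasure_map hme.measurable.aemeasurable, fun k => ?_, fun k => ?_⟩
  · rw [hme.integrable_map_iff]
    exact (BoundedContinuousFunction.mkOfCompact ⟨fun t : Set.Icc (-(D : ℝ)) D => (t : ℝ) ^ k,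
      by fun_prop⟩).integrable _
  · rw [hme.integral_map]
    exact hν k

lemma isSpectralMeasure_spectralMeasure {V : Type*} (H : SimpleGraph V) {D : ℕ}
    (hD : ∀ v, (H.neighborSet v).encard ≤ D) (x : V) :
    IsSpectralMeasure H x (spectralMeasure H x) := by
  have h := exists_isSpectralMeasure H hD x
  rw [spectralMeasure, dif_pos h]
  exact h.choose_spec

/-- The support of a spectral measure is controlled by its even moments, which are at most
`D ^ (2 k)`. Uniqueness of the spectral measure is not needed. -/
lemma IsSpectralMeasure.measure_compl_Icc {V : Type*} {H : SimpleGraph V} {D : ℕ}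
    (hD : ∀ v, (H.neighborSet v).encard ≤ D) {x : V} {μ : Measure ℝ}
    (hμ : IsSpectralMeasure H x μ) : μ (Set.Icc (-(D : ℝ)) D)ᶜ = 0 := by
  have := hμ.isProb
  obtain ⟨ν, hν⟩ := exists_probabilityMeasure H hD x
  have hmom : ∀ k : ℕ, ∫ t, t ^ (2 * k) ∂μ ≤ (D : ℝ) ^ (2 * k) := by
    intro k
    have h1 : ∫ t, t ^ (2 * k) ∂μ =
        ∫ t, (t : ℝ) ^ (2 * k) ∂(ν : Measure (Set.Icc (-(D : ℝ)) D)) :=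
      Complex.ofReal_injective ((hμ.moment _).trans (hν _).symm)
    rw [h1]
    have h2 := norm_integral_le_of_norm_le_const
      (μ := (ν : Measure (Set.Icc (-(D : ℝ)) D))) (C := (D : ℝ) ^ (2 * k))
      (f := fun t => (t : ℝ) ^ (2 * k)) (Eventually.of_forall fun t => by
        rw [norm_pow, Real.norm_eq_abs]
        exact pow_le_pow_left₀ (abs_nonneg _) (abs_le.2 t.2) _)
    rw [probReal_univ, mul_one] at h2
    exact (le_abs_self _).trans h2
  have htail : ∀ r : ℝ, (D : ℝ) < r → μ {t | r ≤ |t|} = 0 := by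
    intro r hr
    have hr0 : 0 < r := (Nat.cast_nonneg D).trans_lt hr
    have hle : ∀ k : ℕ, μ.real {t | r ≤ |t|} ≤ ((D : ℝ) / r) ^ (2 * k) := by
      intro k
      have h1 := mul_meas_ge_le_integral_of_nonneg (μ := μ) (f := fun t => t ^ (2 * k))
        (Eventually.of_forall fun t => (even_two_mul k).pow_nonneg t) (hμ.integrable _)
        (r ^ (2 * k))
      rw [div_pow, le_div_iff₀ (by positivity), mul_comm]
      refine le_trans ?_ (h1.trans (hmom k))
      refine mul_le_mul_of_nonneg_left (measureReal_mono fun t ht => ?_) (by positivity)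
      change r ^ (2 * k) ≤ t ^ (2 * k)
      rw [← (even_two_mul k).pow_abs t]
      exact pow_le_pow_left₀ hr0.le ht _
    have hlim : Tendsto (fun k : ℕ => ((D : ℝ) / r) ^ (2 * k)) atTop (𝓝 0) := by
      simp_rw [pow_mul]
      refine tendsto_pow_atTop_nhds_zero_of_lt_one (by positivity) ?_
      refine pow_lt_one₀ (by positivity) ?_ two_ne_zero
      exact (div_lt_one hr0).2 hr
    have h0 : μ.real {t | r ≤ |t|} ≤ 0 := ge_of_tendsto' hlim hle
    exact (measureReal_eq_zero_iff).1 (le_antisymm h0 measureReal_nonneg)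
  have hsub : (Set.Icc (-(D : ℝ)) D)ᶜ ⊆ ⋃ n : ℕ, {t : ℝ | D + 1 / ((n : ℝ) + 1) ≤ |t|} := by
    intro t ht
    have ht' : (D : ℝ) < |t| := by
      by_contra hn
      exact ht (abs_le.1 (not_lt.1 hn))
    obtain ⟨n, hn⟩ := exists_nat_one_div_lt (sub_pos.2 ht')
    exact Set.mem_iUnion.2 ⟨n, by
      simp only [Set.mem_ofPred_eq]
      linarith⟩
  refine measure_mono_null hsub (measure_iUnion_null fun n => htail _ ?_)
  have : (0 : ℝ) < 1 / ((n : ℝ) + 1) := by positivity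
  linarith

lemma IsSpectralMeasure.integrable_eval {V : Type*} {H : SimpleGraph V} {x : V} {μ : Measure ℝ}
    (hμ : IsSpectralMeasure H x μ) (P : ℝ[X]) : Integrable (fun t => P.eval t) μ := by
  simp_rw [eval_eq_sum, Polynomial.sum]
  exact integrable_finsetSum _ fun i _ => (hμ.integrable i).const_mul _

lemma IsSpectralMeasure.integral_eval {V : Type*} {H : SimpleGraph V} {x : V} {μ : Measure ℝ}
    (hμ : IsSpectralMeasure H x μ) (P : ℝ[X]) : ∫ t, P.eval t ∂μ = polyMoment H x P := by
  simp_rw [eval_eq_sum, Polynomial.sum]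
  rw [integral_finsetSum _ fun i _ => (hμ.integrable i).const_mul _, polyMoment, Polynomial.sum]
  refine Finset.sum_congr rfl fun i _ => ?_
  rw [integral_const_mul]
  congr 1
  have := hμ.moment i
  rw [vertexMoment, ← this, Complex.ofReal_re]

lemma encard_neighborSet_percGraph_le {V : Type*} {G : SimpleGraph V} {D : ℕ}
    (hD : ∀ v, (G.neighborSet v).encard ≤ D) (ω : G.edgeSet → Bool) (v : V) :
    ((percGraph G ω).neighborSet v).encard ≤ D :=
  (Set.encard_le_encard fun _ hz => hz.1).trans (hD v)

/-- A polynomial moment depends on finitely many edges only. -/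
lemma measurable_polyMoment_percGraph {V : Type*} {G : SimpleGraph V}
    (hfin : ∀ v, (G.neighborSet v).Finite) (x : V) (P : ℝ[X]) :
    Measurable fun ω : G.edgeSet → Bool => polyMoment (percGraph G ω) x P := by
  have := (finite_ballSet hfin x P.natDegree).to_subtype
  let e : G.induce (ballSet G x P.natDegree) ↪g G := SimpleGraph.Embedding.induce _
  let x₀ : ballSet G x P.natDegree := ⟨x, mem_ballSet_self G x _⟩
  have h : (fun ω : G.edgeSet → Bool => polyMoment (percGraph G ω) x P) =
      (fun η => polyMoment (percGraph (G.induce (ballSet G x P.natDegree)) η) x₀ P) ∘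
        fun ω : G.edgeSet → Bool => ω ∘ edgeMap e := by
    ext ω
    exact polyMoment_percGraph_embedding e x₀ P.natDegree hfin (fun u hu => ⟨⟨u, hu⟩, rfl⟩) le_rfl ω
  have h1 : Measurable fun η : (G.induce (ballSet G x P.natDegree)).edgeSet → Bool =>
      polyMoment (percGraph (G.induce (ballSet G x P.natDegree)) η) x₀ P := Measurable.of_discrete
  have h2 : Measurable fun ω : G.edgeSet → Bool => ω ∘ edgeMap e := by
    rw [measurable_pi_iff]
    exact fun a => measurable_pi_apply _
  rw [h]
  exact h1.comp h2

section Measurability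

variable {V : Type*} {G : SimpleGraph V} {D : ℕ}

lemma measurable_integral_spectralMeasure (hD : ∀ v, (G.neighborSet v).encard ≤ D) (x : V)
    {f : ℝ → ℝ} (hf : Continuous f) (hfb : ∃ B, ∀ t, |f t| ≤ B) :
    Measurable fun ω : G.edgeSet → Bool => ∫ t, f t ∂(spectralMeasure (percGraph G ω) x) := by
  have hfin := finite_neighborSet_of_encard_le hD
  have happ : ∀ n : ℕ, ∃ P : ℝ[X], ∀ t ∈ Set.Icc (-(D : ℝ)) D,
      |P.eval t - f t| < 1 / ((n : ℝ) + 1) := fun n =>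
    exists_polynomial_near_of_continuousOn _ _ f hf.continuousOn _ (by positivity)
  choose P hP using happ
  obtain ⟨B, hB⟩ := hfb
  refine measurable_of_tendsto_metrizable
    (f := fun n (ω : G.edgeSet → Bool) => polyMoment (percGraph G ω) x (P n))
    (fun n => measurable_polyMoment_percGraph hfin x (P n)) ?_
  rw [tendsto_pi_nhds]
  intro ω
  have hD' := encard_neighborSet_percGraph_le hD ω
  have hμ := isSpectralMeasure_spectralMeasure (percGraph G ω) hD' x
  have hsupp := hμ.measure_compl_Icc hD'
  have := hμ.isProb
  set μ := spectralMeasure (percGraph G ω) x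
  have hfi : Integrable f μ := Integrable.of_bound hf.aestronglyMeasurable B
    (Eventually.of_forall hB)
  rw [tendsto_iff_dist_tendsto_zero]
  refine squeeze_zero (fun _ => dist_nonneg) (fun n => ?_) tendsto_one_div_add_atTop_nhds_zero_nat
  rw [← hμ.integral_eval, Real.dist_eq, ← integral_sub (hμ.integrable_eval _) hfi]
  have h2 := norm_integral_le_of_norm_le_const (μ := μ) (C := 1 / ((n : ℝ) + 1))
    (f := fun t => (P n).eval t - f t) (by
      filter_upwards [compl_mem_ae_iff.2 hsupp] with t ht
      rw [compl_compl] at ht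
      exact (hP n t ht).le)
  rwa [probReal_univ, mul_one] at h2

/-- Integrals of continuous functions are limits of polynomial moments, hence measurable in the
configuration; closed sets are then reached by outer approximation. -/
lemma measurable_spectralMeasure (hD : ∀ v, (G.neighborSet v).encard ≤ D) (x : V) :
    Measurable fun ω : G.edgeSet → Bool => spectralMeasure (percGraph G ω) x := by
  have hprob : ∀ ω : G.edgeSet → Bool, IsProbabilityMeasure (spectralMeasure (percGraph G ω) x) :=
    fun ω => (isSpectralMeasure_spectralMeasure (percGraph G ω)
      (encard_neighborSet_percGraph_le hD ω) x).isProb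
  refine Measurable.measure_of_isPiSystem_of_isProbabilityMeasure
    (borel_eq_generateFrom_isClosed (α := ℝ) ▸ BorelSpace.measurable_eq) isPiSystem_isClosed ?_
  intro F hF
  have hF' : IsClosed F := hF
  refine measurable_of_tendsto_metrizable
    (f := fun n (ω : G.edgeSet → Bool) =>
      ∫⁻ t, hF'.apprSeq n t ∂(spectralMeasure (percGraph G ω) x)) (fun n => ?_) ?_
  · have h : ∀ ω : G.edgeSet → Bool, ∫⁻ t, hF'.apprSeq n t ∂(spectralMeasure (percGraph G ω) x) =
        ENNReal.ofReal (∫ t, (hF'.apprSeq n t : ℝ) ∂(spectralMeasure (percGraph G ω) x)) := by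
      intro ω
      rw [ofReal_integral_eq_lintegral_ofReal]
      · simp
      · refine Integrable.of_bound (C := 1)
          (NNReal.continuous_coe.comp (hF'.apprSeq n).continuous).aestronglyMeasurable
          (Eventually.of_forall fun t => ?_)
        rw [Real.norm_eq_abs, NNReal.abs_eq]
        exact_mod_cast HasOuterApproxClosed.apprSeq_apply_le_one hF' n t
      · exact Eventually.of_forall fun t => NNReal.coe_nonneg _
    simp_rw [h]
    refine (measurable_integral_spectralMeasure hD x
      (NNReal.continuous_coe.comp (hF'.apprSeq n).continuous) ⟨1, fun t => ?_⟩).ennreal_ofReal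
    simp only [Function.comp_apply, NNReal.abs_eq]
    exact_mod_cast HasOuterApproxClosed.apprSeq_apply_le_one hF' n t
  · rw [tendsto_pi_nhds]
    intro ω
    have := hprob ω
    exact HasOuterApproxClosed.tendsto_lintegral_apprSeq hF' _

end Measurability

/-! ### Expected excess on the infinite graph -/

instance isProbabilityMeasure_edgeLaw {V : Type*} (G : SimpleGraph V) (p : unitInterval) :
    IsProbabilityMeasure (edgeLaw G p) := by
  unfold edgeLaw
  infer_instance

/-- The part above the threshold `L / (2 m)` of the masses `⟨e_x, P_j(A) e_x⟩` given by the
spectral measure at `x` to the polynomial partition of unity. -/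
def excess {V : Type*} {m : ℕ} (P : Fin (2 * m) → ℝ[X]) (L : ℝ) (H : SimpleGraph V) (x : V) : ℝ :=
  ∑ j, max (polyMoment H x (P j) - L / (2 * m)) 0

lemma excess_nonneg {V : Type*} {m : ℕ} (P : Fin (2 * m) → ℝ[X]) (L : ℝ) (H : SimpleGraph V)
    (x : V) : 0 ≤ excess P L H x :=
  Finset.sum_nonneg fun _ _ => le_max_right _ _

section

variable {V : Type*} {H : SimpleGraph V} {D : ℕ} {R : ℝ} {m : ℕ} {P : Fin (2 * m) → ℝ[X]}

lemma IsSpectralMeasure.ae_mem_Icc {x : V} {μ : Measure ℝ} (hμ : IsSpectralMeasure H x μ)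
    (hD : ∀ v, (H.neighborSet v).encard ≤ D) (hR : (D : ℝ) ≤ R) :
    ∀ᵐ t ∂μ, t ∈ Set.Icc (-R) R := by
  filter_upwards [compl_mem_ae_iff.2 (hμ.measure_compl_Icc hD)] with t ht
  rw [compl_compl] at ht
  exact ⟨by linarith [ht.1], by linarith [ht.2]⟩

lemma polyMoment_nonneg (hD : ∀ v, (H.neighborSet v).encard ≤ D) (hR : (D : ℝ) ≤ R)
    (hP : IsPolyPartition R m P) (x : V) (j : Fin (2 * m)) : 0 ≤ polyMoment H x (P j) := by
  have hμ := isSpectralMeasure_spectralMeasure H hD x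
  rw [← hμ.integral_eval]
  refine integral_nonneg_of_ae ?_
  filter_upwards [hμ.ae_mem_Icc hD hR] with t ht
  exact hP.nonneg j t ht

lemma sum_polyMoment (hD : ∀ v, (H.neighborSet v).encard ≤ D) (hR : (D : ℝ) ≤ R)
    (hP : IsPolyPartition R m P) (x : V) : ∑ j, polyMoment H x (P j) = 1 := by
  have hμ := isSpectralMeasure_spectralMeasure H hD x
  have := hμ.isProb
  simp_rw [← hμ.integral_eval]
  rw [← integral_finsetSum _ fun j _ => hμ.integrable_eval _]
  have h : ∀ᵐ t ∂(spectralMeasure H x), ∑ j, (P j).eval t = (fun _ => (1 : ℝ)) t := by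
    filter_upwards [hμ.ae_mem_Icc hD hR] with t ht
    exact hP.sum_eq t ht
  rw [integral_congr_ae h]
  simp

lemma excess_le_one (hD : ∀ v, (H.neighborSet v).encard ≤ D) (hR : (D : ℝ) ≤ R)
    (hP : IsPolyPartition R m P) {L : ℝ} (hL : 0 ≤ L) (x : V) : excess P L H x ≤ 1 := by
  rw [← sum_polyMoment hD hR hP x]
  refine Finset.sum_le_sum fun j _ => max_le ?_ (polyMoment_nonneg hD hR hP x j)
  have : 0 ≤ L / (2 * m) := by positivity
  linarith

end

/-- Passing to a finite reference measure, as the Lebesgue decomposition of kernels requires. -/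
lemma singularPart_volume_eq {μ : Measure ℝ} [IsFiniteMeasure μ] {I : Set ℝ}
    (hI : MeasurableSet I) (hμ : μ Iᶜ = 0) :
    μ.singularPart volume = μ.singularPart (volume.restrict I) := by
  set σ := μ.singularPart (volume.restrict I) with hσ
  have hσI : σ Iᶜ = 0 := Measure.absolutelyContinuous_of_le (Measure.singularPart_le _ _) hμ
  obtain ⟨S, hS, hS1, hS2⟩ := Measure.mutuallySingular_singularPart μ (volume.restrict I)
  symm
  refine Measure.eq_singularPart (f := I.indicator (μ.rnDeriv (volume.restrict I)))
    ((Measure.measurable_rnDeriv _ _).indicator hI) ⟨S ∪ Iᶜ, hS.union hI.compl, ?_, ?_⟩ ?_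
  · exact measure_union_null hS1 hσI
  · rw [Measure.restrict_apply hS.compl] at hS2
    rwa [Set.compl_union, compl_compl]
  · rw [withDensity_indicator hI]
    exact Measure.haveLebesgueDecomposition_add _ _

/-- The part of the density below `K` contributes at most `K π R / (2 m)` to each mass, so only the
singular part and the part of the density above `K` can push a mass over that threshold. -/
lemma ofReal_sum_max_le {μ σ : Measure ℝ} [IsProbabilityMeasure μ] {R : ℝ} {m : ℕ}
    {P : Fin (2 * m) → ℝ[X]} (hR : 0 < R) (hP : IsPolyPartition R m P)
    (hint : ∀ j, Integrable (fun t => (P j).eval t) μ)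
    (hμ : ∀ᵐ t ∂μ, t ∈ Set.Icc (-R) R) {ρ : ℝ → ENNReal} (hρ : Measurable ρ)
    (hdec : μ = σ + (volume.restrict (Set.Icc (-R) R)).withDensity ρ) (K : ℕ) :
    ENNReal.ofReal (∑ j, max (∫ t, (P j).eval t ∂μ - K * Real.pi * R / (2 * m)) 0) ≤
      σ Set.univ + ∫⁻ t, (ρ t - K) ∂(volume.restrict (Set.Icc (-R) R)) := by
  set ν := volume.restrict (Set.Icc (-R) R) with hν
  set g : Fin (2 * m) → ℝ → ENNReal := fun j t => ENNReal.ofReal ((P j).eval t) with hg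
  have hgm : ∀ j, Measurable (g j) := fun j => by
    have : Measurable fun t => (P j).eval t := (P j).continuous.measurable
    exact this.ennreal_ofReal
  have hσμ : σ ≤ μ := by rw [hdec]; exact Measure.le_add_right le_rfl
  have hσI : ∀ᵐ t ∂σ, t ∈ Set.Icc (-R) R :=
    (Measure.absolutelyContinuous_of_le hσμ).ae_le hμ
  have hνI : ∀ᵐ t ∂ν, t ∈ Set.Icc (-R) R := ae_restrict_mem measurableSet_Icc
  have hsum : ∀ t ∈ Set.Icc (-R) R, ∑ j, g j t = 1 := by
    intro t ht
    simp only [hg]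
    rw [← ENNReal.ofReal_sum_of_nonneg fun j _ => hP.nonneg j t ht, hP.sum_eq t ht,
      ENNReal.ofReal_one]
  have hgν : ∀ j, ∫⁻ t, g j t ∂ν ≤ ENNReal.ofReal (Real.pi * R / (2 * m)) := by
    intro j
    have hi : Integrable (fun t => (P j).eval t) ν :=
      ((P j).continuous.continuousOn).integrableOn_compact isCompact_Icc
    rw [← ofReal_integral_eq_lintegral_ofReal hi (by
      filter_upwards [hνI] with t ht
      exact hP.nonneg j t ht)]
    refine ENNReal.ofReal_le_ofReal ?_
    have := hP.integral_le j
    rwa [intervalIntegral.integral_of_le (by linarith), ← integral_Icc_eq_integral_Ioc] at this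
  have hj : ∀ j, ENNReal.ofReal (max (∫ t, (P j).eval t ∂μ - K * Real.pi * R / (2 * m)) 0) ≤
      ∫⁻ t, g j t ∂σ + ∫⁻ t, g j t * (ρ t - K) ∂ν := by
    intro j
    have e1 : ENNReal.ofReal (max (∫ t, (P j).eval t ∂μ - K * Real.pi * R / (2 * m)) 0) =
        ENNReal.ofReal (∫ t, (P j).eval t ∂μ) -
          ENNReal.ofReal (K * Real.pi * R / (2 * m)) := by
      rw [← ENNReal.ofReal_sub _ (by positivity)]
      rcases le_total (∫ t, (P j).eval t ∂μ - K * Real.pi * R / (2 * m)) 0 with h | h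
      · rw [max_eq_right h, ENNReal.ofReal_of_nonpos h, ENNReal.ofReal_zero]
      · rw [max_eq_left h]
    rw [e1, tsub_le_iff_right, ofReal_integral_eq_lintegral_ofReal (hint j) (by
      filter_upwards [hμ] with t ht
      exact hP.nonneg j t ht)]
    change ∫⁻ t, g j t ∂μ ≤ _
    rw [hdec, lintegral_add_measure, add_assoc]
    refine add_le_add le_rfl ?_
    rw [lintegral_withDensity_eq_lintegral_mul _ hρ (hgm j)]
    have hK : ∫⁻ t, g j t * K ∂ν ≤ ENNReal.ofReal (K * Real.pi * R / (2 * m)) := by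
      rw [lintegral_mul_const _ (hgm j)]
      refine (mul_le_mul_left (hgν j) _).trans ?_
      rw [← ENNReal.ofReal_natCast K, ← ENNReal.ofReal_mul (by positivity)]
      apply le_of_eq
      congr 1
      ring
    calc ∫⁻ t, (ρ * g j) t ∂ν ≤ ∫⁻ t, (g j t * (ρ t - K) + g j t * K) ∂ν := by
          refine lintegral_mono fun t => ?_
          rw [Pi.mul_apply, ← mul_add, mul_comm]
          exact mul_le_mul_right le_tsub_add _
      _ = ∫⁻ t, g j t * (ρ t - K) ∂ν + ∫⁻ t, g j t * K ∂ν :=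
          lintegral_add_right _ ((hgm j).mul_const _)
      _ ≤ _ := add_le_add le_rfl hK
  rw [ENNReal.ofReal_sum_of_nonneg fun _ _ => le_max_right _ _]
  refine (Finset.sum_le_sum fun j _ => hj j).trans ?_
  rw [Finset.sum_add_distrib]
  refine add_le_add ?_ ?_
  · rw [← lintegral_finsetSum _ fun j _ => hgm j, ← lintegral_one]
    refine (lintegral_congr_ae ?_).le
    filter_upwards [hσI] with t ht
    exact hsum t ht
  · have hm : ∀ j, Measurable fun t => g j t * (ρ t - K) := fun j => (hgm j).mul (hρ.sub_const _)
    rw [← lintegral_finsetSum _ fun j _ => hm j]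
    refine (lintegral_congr_ae ?_).le
    filter_upwards [hνI] with t ht
    rw [← Finset.sum_mul, hsum t ht, one_mul]

section Expectation

variable {U : Type*} {Γ : SimpleGraph U} {D : ℕ}

/-- The spectral measure at `o` of the percolation graph, as a Markov kernel. -/
def spectralKernel (hD : ∀ v, (Γ.neighborSet v).encard ≤ D) (o : U) :
    Kernel (Γ.edgeSet → Bool) ℝ :=
  ⟨fun ω => spectralMeasure (percGraph Γ ω) o, measurable_spectralMeasure hD o⟩

instance isMarkovKernel_spectralKernel (hD : ∀ v, (Γ.neighborSet v).encard ≤ D) (o : U) :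
    IsMarkovKernel (spectralKernel hD o) :=
  ⟨fun ω => (isSpectralMeasure_spectralMeasure (percGraph Γ ω)
    (encard_neighborSet_percGraph_le hD ω) o).isProb⟩

lemma singularPart_spectralMeasure_eq (hD : ∀ v, (Γ.neighborSet v).encard ≤ D) (o : U) {R : ℝ}
    (hR : (D : ℝ) ≤ R) (ω : Γ.edgeSet → Bool) :
    (spectralMeasure (percGraph Γ ω) o).singularPart volume =
      (spectralKernel hD o ω).singularPart (volume.restrict (Set.Icc (-R) R)) := by
  have hμ := isSpectralMeasure_spectralMeasure (percGraph Γ ω)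
    (encard_neighborSet_percGraph_le hD ω) o
  have := hμ.isProb
  exact singularPart_volume_eq measurableSet_Icc
    (hμ.ae_mem_Icc (encard_neighborSet_percGraph_le hD ω) hR)

lemma measurable_singularPart_spectralMeasure (hD : ∀ v, (Γ.neighborSet v).encard ≤ D) (o : U) :
    Measurable fun ω : Γ.edgeSet → Bool =>
      (spectralMeasure (percGraph Γ ω) o).singularPart volume Set.univ := by
  simp_rw [singularPart_spectralMeasure_eq hD o le_rfl]
  exact (Measure.measurable_coe MeasurableSet.univ).comp
    (Kernel.measurable_singularPart (spectralKernel hD o)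
      (Kernel.const _ (volume.restrict (Set.Icc (-(D : ℝ)) D))))

lemma singularPart_spectralMeasure_le_one (hD : ∀ v, (Γ.neighborSet v).encard ≤ D) (o : U)
    (ω : Γ.edgeSet → Bool) :
    (spectralMeasure (percGraph Γ ω) o).singularPart volume Set.univ ≤ 1 := by
  have := (isSpectralMeasure_spectralMeasure (percGraph Γ ω)
    (encard_neighborSet_percGraph_le hD ω) o).isProb
  exact (Measure.singularPart_le _ _ _).trans prob_le_one

lemma lintegral_singularPart_le_one (hD : ∀ v, (Γ.neighborSet v).encard ≤ D) (o : U)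
    (p : unitInterval) :
    ∫⁻ ω, (spectralMeasure (percGraph Γ ω) o).singularPart volume Set.univ ∂(edgeLaw Γ p) ≤ 1 := by
  refine (lintegral_mono fun ω => singularPart_spectralMeasure_le_one hD o ω).trans ?_
  simp

lemma expectedSingularMass_lt_one (hD : ∀ v, (Γ.neighborSet v).encard ≤ D) (o : U)
    (p : unitInterval)
    (hac : 0 < edgeLaw Γ p {ω | HasACPart (spectralMeasure (percGraph Γ ω) o)}) :
    expectedSingularMass Γ o p < 1 := by
  have hle := lintegral_singularPart_le_one hD o p
  have hne : ∫⁻ ω, (spectralMeasure (percGraph Γ ω) o).singularPart volume Set.univ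
      ∂(edgeLaw Γ p) ≠ 1 := by
    intro h
    have hae := ae_eq_of_ae_le_of_lintegral_le (μ := edgeLaw Γ p)
      (f := fun ω => (spectralMeasure (percGraph Γ ω) o).singularPart volume Set.univ)
      (g := fun _ => 1)
      (Eventually.of_forall fun ω => singularPart_spectralMeasure_le_one hD o ω)
      (by rw [h]; simp) measurable_const.aemeasurable (by rw [h]; simp)
    refine hac.ne' (measure_mono_null ?_ hae)
    intro ω hω hω1
    have hprob := (isSpectralMeasure_spectralMeasure (percGraph Γ ω)
      (encard_neighborSet_percGraph_le hD ω) o).isProb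
    have hω' : 0 < (volume.withDensity
      ((spectralMeasure (percGraph Γ ω) o).rnDeriv volume)) Set.univ := hω
    have h1 : (spectralMeasure (percGraph Γ ω) o).singularPart volume Set.univ = 1 := hω1
    have h2 := congrArg (fun μ : Measure ℝ => μ Set.univ)
      (Measure.haveLebesgueDecomposition_add (spectralMeasure (percGraph Γ ω) o) volume)
    simp only [Measure.add_apply, h1, measure_univ] at h2
    have h3 : (1 : ENNReal) + 0 < 1 + (volume.withDensity
        ((spectralMeasure (percGraph Γ ω) o).rnDeriv volume)) Set.univ :=
      ENNReal.add_lt_add_left ENNReal.one_ne_top hω'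
    rw [← h2, add_zero] at h3
    exact lt_irrefl _ h3
  have hlt := lt_of_le_of_ne hle hne
  rw [expectedSingularMass]
  have := (ENNReal.toReal_lt_toReal (hlt.ne_top) ENNReal.one_ne_top).2 hlt
  simpa using this

/-- Uniformly over all scales `m`, the expected excess mass is controlled by the expected singular
mass, once the threshold constant `L` is large. -/
lemma exists_integral_excess_le (hD : ∀ v, (Γ.neighborSet v).encard ≤ D) (o : U)
    (p : unitInterval) {R : ℝ} (hR0 : 0 < R) (hR : (D : ℝ) ≤ R) {ε : ℝ} (hε : 0 < ε) :
    ∃ L : ℝ, 0 < L ∧ ∀ (m : ℕ) (P : Fin (2 * m) → ℝ[X]), IsPolyPartition R m P →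
      ∫ ω, excess P L (percGraph Γ ω) o ∂(edgeLaw Γ p) ≤ expectedSingularMass Γ o p + ε := by
  set κ := spectralKernel hD o with hκ
  set ν := volume.restrict (Set.Icc (-R) R) with hν
  set η : Kernel (Γ.edgeSet → Bool) ℝ := Kernel.const _ ν with hη
  set ρ : (Γ.edgeSet → Bool) → ℝ → ENNReal := Kernel.rnDeriv κ η with hρ
  have hρm : Measurable fun z : (Γ.edgeSet → Bool) × ℝ => ρ z.1 z.2 :=
    Kernel.measurable_rnDeriv κ η
  have hdec : ∀ ω, κ ω = (κ ω).singularPart ν + ν.withDensity (ρ ω) := by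
    intro ω
    have h1 := Kernel.singularPart_eq_singularPart_measure (κ := κ) (η := η) (a := ω)
    have h2 := congrArg (fun k : Kernel (Γ.edgeSet → Bool) ℝ => k ω)
      (Kernel.rnDeriv_add_singularPart κ η)
    simp only [add_apply] at h2
    rw [Kernel.withDensity_apply _ hρm, h1, add_comm] at h2
    exact h2.symm
  have hρ1 : ∫⁻ z, ρ z.1 z.2 ∂((edgeLaw Γ p).prod ν) ≤ 1 := by
    rw [lintegral_prod _ hρm.aemeasurable]
    calc ∫⁻ ω, ∫⁻ t, ρ ω t ∂ν ∂(edgeLaw Γ p) ≤ ∫⁻ _, 1 ∂(edgeLaw Γ p) := by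
          refine lintegral_mono fun ω => ?_
          have h1 := congrArg (fun μ : Measure ℝ => μ Set.univ) (hdec ω)
          simp only [Measure.add_apply, measure_univ, withDensity_apply _ MeasurableSet.univ,
            Measure.restrict_univ] at h1
          rw [h1]
          exact le_add_self
      _ = 1 := by simp
  have hlim : Tendsto (fun n : ℕ => ∫⁻ z, (ρ z.1 z.2 - n) ∂((edgeLaw Γ p).prod ν)) atTop
      (𝓝 (∫⁻ _, 0 ∂((edgeLaw Γ p).prod ν))) := by
    refine tendsto_lintegral_of_dominated_convergence (fun z => ρ z.1 z.2)
      (fun n => hρm.sub_const _) (fun n => Eventually.of_forall fun z => tsub_le_self)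
      (ne_top_of_le_ne_top ENNReal.one_ne_top hρ1) ?_
    filter_upwards [ae_lt_top hρm (ne_top_of_le_ne_top ENNReal.one_ne_top hρ1)] with z hz
    obtain ⟨N, hN⟩ := ENNReal.exists_nat_gt hz.ne
    refine tendsto_const_nhds.congr' ?_
    filter_upwards [eventually_ge_atTop N] with n hn
    exact (tsub_eq_zero_of_le (hN.le.trans (by exact_mod_cast hn))).symm
  rw [lintegral_zero] at hlim
  obtain ⟨n, hn0, hn⟩ := ((eventually_gt_atTop 0).and
    (hlim.eventually (gt_mem_nhds (ENNReal.ofReal_pos.2 hε)))).exists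
  refine ⟨n * Real.pi * R, by positivity, fun m P hP => ?_⟩
  have hfin := lintegral_singularPart_le_one hD o p
  have hpt : ∀ ω, ENNReal.ofReal (excess P (n * Real.pi * R) (percGraph Γ ω) o) ≤
      (spectralMeasure (percGraph Γ ω) o).singularPart volume Set.univ +
        ∫⁻ t, (ρ ω t - n) ∂ν := by
    intro ω
    have hμ := isSpectralMeasure_spectralMeasure (percGraph Γ ω)
      (encard_neighborSet_percGraph_le hD ω) o
    have := hμ.isProb
    have h1 := ofReal_sum_max_le (μ := spectralMeasure (percGraph Γ ω) o) hR0 hP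
      (fun j => hμ.integrable_eval _)
      (hμ.ae_mem_Icc (encard_neighborSet_percGraph_le hD ω) hR)
      (hρm.comp measurable_prodMk_left) (hdec ω) n
    rw [singularPart_spectralMeasure_eq hD o hR]
    simp_rw [hμ.integral_eval] at h1
    exact h1
  rw [integral_eq_lintegral_of_nonneg_ae (Eventually.of_forall fun ω => excess_nonneg _ _ _ _)]
  · refine ENNReal.toReal_le_of_le_ofReal (by
      have : 0 ≤ expectedSingularMass Γ o p := ENNReal.toReal_nonneg
      linarith) ?_
    rw [expectedSingularMass, ENNReal.ofReal_add ENNReal.toReal_nonneg hε.le,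
      ENNReal.ofReal_toReal (ne_top_of_le_ne_top ENNReal.one_ne_top hfin)]
    refine (lintegral_mono hpt).trans ?_
    rw [lintegral_add_left (measurable_singularPart_spectralMeasure hD o)]
    refine add_le_add le_rfl ?_
    rw [← lintegral_prod (fun z : (Γ.edgeSet → Bool) × ℝ => ρ z.1 z.2 - n)
      (hρm.sub_const _).aemeasurable]
    exact hn.le
  · have hfin := finite_neighborSet_of_encard_le hD
    refine Measurable.aestronglyMeasurable ?_
    unfold excess
    exact Finset.measurable_sum _ fun j _ =>
      ((measurable_polyMoment_percGraph hfin o (P j)).sub_const _).max measurable_const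

end Expectation

/-! ### Large eigenvector entries on finite graphs -/

section Eigenvectors

variable {V : Type*} [Fintype V]

/-- The squared mass carried at `x` by the eigenvectors that are larger than `κ` at `x` is bounded
by the excess of the spectral measure at `x`, up to an error which is small if `κ` is large compared
with the square root of the threshold. -/
lemma sum_large_sq_le_excess {ι : Type*} [Fintype ι] {H : SimpleGraph V}
    {ψ : OrthonormalBasis ι ℂ (EuclideanSpace ℂ V)} {lam : ι → ℝ} (hψ : HasEigenvalues H ψ lam)
    {D : ℕ} (hD : ∀ v, (H.neighborSet v).encard ≤ D) {R : ℝ} (hR : (D : ℝ) ≤ R) {m : ℕ}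
    {P : Fin (2 * m) → ℝ[X]} (hP : IsPolyPartition R m P) {L κ : ℝ} (hL : 0 ≤ L) (hκ : 0 < κ)
    (x : V) :
    ∑ k, (if κ < ‖ψ k x‖ then ‖ψ k x‖ ^ 2 else 0) ≤
      excess P L H x + 3 * Real.sqrt (L / (2 * m)) / κ := by
  classical
  set B : Finset ι := Finset.univ.filter fun k => κ < ‖ψ k x‖ with hB
  rw [← Finset.sum_filter]
  have hlam : ∀ k, lam k ∈ Set.Icc (-R) R := fun k => by
    have := abs_le.1 (abs_eigenvalue_le hψ hD k)
    exact ⟨by linarith [this.1], by linarith [this.2]⟩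
  set θ : ℝ := L / (2 * m) with hθ
  have hθ0 : 0 ≤ θ := by positivity
  set b : Fin (2 * m) → ℝ := fun j => ∑ k ∈ B, (P j).eval (lam k) * ‖ψ k x‖ ^ 2 with hb
  have hterm : ∀ j k, 0 ≤ (P j).eval (lam k) * ‖ψ k x‖ ^ 2 := fun j k =>
    mul_nonneg (hP.nonneg j _ (hlam k)) (by positivity)
  have hb0 : ∀ j, 0 ≤ b j := fun j => Finset.sum_nonneg fun k _ => hterm j k
  have hba : ∀ j, b j ≤ polyMoment H x (P j) := by
    intro j
    rw [polyMoment_eq_sum hψ]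
    exact Finset.sum_le_sum_of_subset_of_nonneg (Finset.subset_univ _) fun k _ _ => hterm j k
  have hsumb : ∑ j, b j = ∑ k ∈ B, ‖ψ k x‖ ^ 2 := by
    simp only [hb]
    rw [Finset.sum_comm]
    refine Finset.sum_congr rfl fun k _ => ?_
    rw [← Finset.sum_mul, hP.sum_eq _ (hlam k), one_mul]
  have hsqrt : ∀ j, Real.sqrt (b j) ≤ ∑ k ∈ B, Real.sqrt ((P j).eval (lam k)) * ‖ψ k x‖ := by
    intro j
    rw [Real.sqrt_le_left (Finset.sum_nonneg fun k _ => by positivity)]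
    have h1 := Finset.sum_sq_le_sq_sum_of_nonneg (s := B)
      (f := fun k => Real.sqrt ((P j).eval (lam k)) * ‖ψ k x‖) (fun k _ => by positivity)
    refine le_trans (le_of_eq ?_) h1
    refine Finset.sum_congr rfl fun k _ => ?_
    rw [mul_pow, Real.sq_sqrt (hP.nonneg j _ (hlam k))]
  have hB1 : ∑ k ∈ B, ‖ψ k x‖ ≤ 1 / κ := by
    rw [le_div_iff₀ hκ, Finset.sum_mul, ← sum_norm_sq_apply ψ x]
    refine le_trans (Finset.sum_le_sum fun k hk => ?_)
      (Finset.sum_le_sum_of_subset_of_nonneg (Finset.subset_univ B) fun k _ _ => by positivity)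
    have : κ < ‖ψ k x‖ := (Finset.mem_filter.1 hk).2
    rw [sq]
    exact mul_le_mul_of_nonneg_left this.le (norm_nonneg _)
  have hsumsqrt : ∑ j, Real.sqrt (b j) ≤ 3 / κ := by
    refine (Finset.sum_le_sum fun j _ => hsqrt j).trans ?_
    rw [Finset.sum_comm]
    calc _ ≤ ∑ k ∈ B, 3 * ‖ψ k x‖ := by
          refine Finset.sum_le_sum fun k _ => ?_
          rw [← Finset.sum_mul]
          exact mul_le_mul_of_nonneg_right (hP.sum_sqrt_le _ (hlam k)) (norm_nonneg _)
      _ = 3 * ∑ k ∈ B, ‖ψ k x‖ := by rw [Finset.mul_sum]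
      _ ≤ 3 * (1 / κ) := by gcongr
      _ = 3 / κ := by ring
  -- A mass `b j` below the threshold `θ` is at most `√θ √(b j)`, and `∑ √(b j)` is bounded.
  have hpt : ∀ j, b j ≤ max (polyMoment H x (P j) - θ) 0 + Real.sqrt θ * Real.sqrt (b j) := by
    intro j
    have h1 := Real.mul_self_sqrt (hb0 j)
    have h2 := Real.mul_self_sqrt hθ0
    rcases le_total (b j) θ with h | h
    · have := mul_le_mul_of_nonneg_right (Real.sqrt_le_sqrt h) (Real.sqrt_nonneg (b j))
      have := le_max_right (polyMoment H x (P j) - θ) 0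
      linarith
    · have := mul_le_mul_of_nonneg_left (Real.sqrt_le_sqrt h) (Real.sqrt_nonneg θ)
      have := le_max_left (polyMoment H x (P j) - θ) 0
      linarith [hba j]
  rw [← hsumb]
  calc ∑ j, b j ≤ ∑ j, (max (polyMoment H x (P j) - θ) 0 + Real.sqrt θ * Real.sqrt (b j)) :=
        Finset.sum_le_sum fun j _ => hpt j
    _ = excess P L H x + Real.sqrt θ * ∑ j, Real.sqrt (b j) := by
        rw [Finset.sum_add_distrib, Finset.mul_sum, excess]
    _ ≤ excess P L H x + Real.sqrt θ * (3 / κ) := by gcongr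
    _ = _ := by ring

/-- Markov's inequality over the vectors of the basis: if the total mass carried by entries larger
than `κ` is at most `θ ^ 2 n`, then at most `θ n` vectors carry more than `θ` of such mass. -/
lemma le_delocalizedCount
    (ψ : OrthonormalBasis (Fin (Fintype.card V)) ℂ (EuclideanSpace ℂ V)) {κ q θ : ℝ} (hθ : 0 < θ)
    (hq : q ≤ θ ^ 2)
    (hbad : ∑ x, ∑ k, (if κ < ‖ψ k x‖ then ‖ψ k x‖ ^ 2 else 0) ≤ q * Fintype.card V) :
    (1 - θ) * Fintype.card V ≤ delocalizedCount (1 - θ) κ ψ := by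
  classical
  set w : Fin (Fintype.card V) → ℝ := fun k =>
    ∑ x, (if κ < ‖ψ k x‖ then ‖ψ k x‖ ^ 2 else 0) with hw
  have hw0 : ∀ k, 0 ≤ w k := fun k => Finset.sum_nonneg fun x _ => by split_ifs <;> positivity
  set T : Finset (Fin (Fintype.card V)) := Finset.univ.filter fun k => θ < w k with hT
  have hTcard : (T.card : ℝ) ≤ θ * Fintype.card V := by
    have h1 : (T.card : ℝ) * θ ≤ θ * Fintype.card V * θ := by
      calc (T.card : ℝ) * θ = ∑ k ∈ T, θ := by rw [Finset.sum_const, nsmul_eq_mul]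
        _ ≤ ∑ k ∈ T, w k := Finset.sum_le_sum fun k hk => (Finset.mem_filter.1 hk).2.le
        _ ≤ ∑ k, w k :=
            Finset.sum_le_sum_of_subset_of_nonneg (Finset.subset_univ _) fun k _ _ => hw0 k
        _ ≤ q * Fintype.card V := by
            simp only [hw]
            rw [Finset.sum_comm]
            exact hbad
        _ ≤ θ ^ 2 * Fintype.card V := by gcongr
        _ = θ * Fintype.card V * θ := by ring
    exact le_of_mul_le_mul_right h1 hθ
  have hdel : ((Tᶜ : Finset (Fin (Fintype.card V))) : Set (Fin (Fintype.card V))) ⊆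
      {k | IsDelocalized (1 - θ) κ (ψ k)} := by
    intro k hk
    have hk' : w k ≤ θ := by simpa [hT] using hk
    refine ⟨Finset.univ.filter fun x => ¬ κ < ‖ψ k x‖, ?_, fun x hx =>
      not_lt.1 (Finset.mem_filter.1 hx).2⟩
    have h1 := Finset.sum_filter_add_sum_filter_not Finset.univ (fun x => κ < ‖ψ k x‖)
      (fun x => ‖ψ k x‖ ^ 2)
    rw [sum_norm_sq_coord] at h1
    simp only [hw] at hk'
    rw [← Finset.sum_filter] at hk'
    linarith
  have h2 : (Tᶜ).card ≤ delocalizedCount (1 - θ) κ ψ := by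
    rw [← Set.ncard_coe_finset]
    exact Set.ncard_le_ncard hdel (Set.toFinite _)
  have h3 : (T.card : ℝ) + (Tᶜ).card = Fintype.card V := by
    rw [← Nat.cast_add, Finset.card_add_card_compl, Fintype.card_fin]
  have h4 : ((Tᶜ).card : ℝ) ≤ delocalizedCount (1 - θ) κ ψ := by exact_mod_cast h2
  linarith

lemma delocalizedCount_of_one_le
    (ψ : OrthonormalBasis (Fin (Fintype.card V)) ℂ (EuclideanSpace ℂ V)) {ρ κ : ℝ} (hκ : 1 ≤ κ)
    (hρ : ρ ≤ 1) : delocalizedCount ρ κ ψ = Fintype.card V := by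
  have : {k | IsDelocalized ρ κ (ψ k)} = Set.univ := by
    refine Set.eq_univ_of_forall fun k => ⟨Finset.univ, ?_, fun x _ => ?_⟩
    · rwa [sum_norm_sq_coord]
    · refine le_trans ?_ hκ
      have h1 := Finset.single_le_sum (f := fun y => ‖ψ k y‖ ^ 2) (fun y _ => by positivity)
        (Finset.mem_univ x)
      rw [sum_norm_sq_coord] at h1
      exact (sq_le_one_iff₀ (norm_nonneg _)).1 h1
  rw [delocalizedCount, this, Set.ncard_univ, Nat.card_fin]

end Eigenvectors

/-! ### Transfer of the expected excess between graphs -/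

section Locality

variable {m h : ℕ} {P : Fin (2 * m) → ℝ[X]} {L : ℝ}

lemma excess_percGraph_embedding {W V : Type*} {K : SimpleGraph W} {G : SimpleGraph V}
    (e : K ↪g G) (x : W) (hfin : ∀ v, (G.neighborSet v).Finite)
    (hball : ballSet G (e x) h ⊆ Set.range e) (hP : ∀ j, (P j).natDegree ≤ h)
    (ω : G.edgeSet → Bool) :
    excess P L (percGraph G ω) (e x) = excess P L (percGraph K (ω ∘ edgeMap e)) x := by
  simp only [excess, polyMoment_percGraph_embedding e x h hfin hball (hP _) ω]

lemma integral_excess_embedding {W V : Type*} [Finite W] {K : SimpleGraph W} {G : SimpleGraph V}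
    (e : K ↪g G) (x : W) (hfin : ∀ v, (G.neighborSet v).Finite)
    (hball : ballSet G (e x) h ⊆ Set.range e) (hP : ∀ j, (P j).natDegree ≤ h)
    (p : unitInterval) :
    ∫ ω, excess P L (percGraph G ω) (e x) ∂(edgeLaw G p) =
      ∫ η, excess P L (percGraph K η) x ∂(edgeLaw K p) := by
  have hmp := measurePreserving_comp_edgeMap e p
  rw [← hmp.map_eq, integral_map hmp.measurable.aemeasurable
    (StronglyMeasurable.of_discrete).aestronglyMeasurable]
  simp_rw [excess_percGraph_embedding e x hfin hball hP]

/-- The expected excess at a vertex depends only on the isomorphism class of its ball. -/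
lemma integral_excess_eq_of_ballIso {V U : Type*} [Finite V] {G : SimpleGraph V}
    {Γ : SimpleGraph U} {x : V} {o : U} (hfin : ∀ v, (Γ.neighborSet v).Finite)
    (hP : ∀ j, (P j).natDegree ≤ h) (p : unitInterval) (hiso : BallIso G x Γ o h) :
    ∫ ω, excess P L (percGraph G ω) x ∂(edgeLaw G p) =
      ∫ ω, excess P L (percGraph Γ ω) o ∂(edgeLaw Γ p) := by
  obtain ⟨φ, hφ⟩ := hiso
  let x₀ : ballSet G x h := ⟨x, mem_ballSet_self G x h⟩
  let e₁ : G.induce (ballSet G x h) ↪g G := SimpleGraph.Embedding.induce _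
  let e₂ : G.induce (ballSet G x h) ↪g Γ :=
    (SimpleGraph.Embedding.induce (ballSet Γ o h)).comp φ.toEmbedding
  have he₂ : e₂ x₀ = o := hφ x₀ rfl
  have h1 := integral_excess_embedding (L := L) e₁ x₀ (fun v => Set.toFinite _)
    (fun u hu => ⟨⟨u, hu⟩, rfl⟩) hP p
  have h2 := integral_excess_embedding (L := L) e₂ x₀ hfin (fun u hu => by
    rw [he₂] at hu
    exact ⟨φ.symm ⟨u, hu⟩, congrArg Subtype.val (φ.apply_symm_apply ⟨u, hu⟩)⟩) hP p
  rw [he₂] at h2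
  exact h1.trans h2.symm

/-- Edges with an endpoint outside the ball of radius `h` around `x` do not affect the excess
at `x`. -/
lemma excess_update_eq {V : Type*} [Finite V] {G : SimpleGraph V} [DecidableEq G.edgeSet] (x : V)
    (hP : ∀ j, (P j).natDegree ≤ h) (ω : G.edgeSet → Bool) (e : G.edgeSet) (b : Bool) {u : V}
    (hu : u ∈ (e : Sym2 V)) (hux : u ∉ ballSet G x h) :
    excess P L (percGraph G (Function.update ω e b)) x = excess P L (percGraph G ω) x := by
  let x₀ : ballSet G x h := ⟨x, mem_ballSet_self G x h⟩
  let e₁ : G.induce (ballSet G x h) ↪g G := SimpleGraph.Embedding.induce _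
  have key := fun ω => excess_percGraph_embedding (L := L) e₁ x₀ (fun v => Set.toFinite _)
    (fun u hu => ⟨⟨u, hu⟩, rfl⟩) hP ω
  have h1 : Function.update ω e b ∘ edgeMap e₁ = ω ∘ edgeMap e₁ := by
    ext a
    have hne : edgeMap e₁ a ≠ e := by
      rintro rfl
      obtain ⟨⟨y, z⟩, hyz⟩ := a
      have : u ∈ s((y : V), (z : V)) := hu
      rcases Sym2.mem_iff.1 this with rfl | rfl
      · exact hux y.2
      · exact hux z.2
    rw [Function.comp_apply, Function.update_of_ne hne, Function.comp_apply]
  have h2 := key (Function.update ω e b)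
  rw [h1] at h2
  exact h2.trans (key ω).symm

end Locality

/-! ### Concentration of the total excess -/

section Concentration

variable {V : Type*} [Fintype V] {m h : ℕ} {P : Fin (2 * m) → ℝ[X]} {L : ℝ}

/-- Each vertex is the chosen endpoint of at most `G.maxDegree` edges. -/
lemma sum_edge_endpoint_le (G : SimpleGraph V) [DecidableRel G.Adj] [Fintype G.edgeSet]
    (f : V → ℝ) (hf : ∀ v, 0 ≤ f v) :
    ∑ e : G.edgeSet, f (Quot.out (e : Sym2 V)).1 ≤ G.maxDegree * ∑ v, f v := by
  classical
  rw [← Finset.sum_fiberwise (s := (Finset.univ : Finset G.edgeSet))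
    (g := fun e : G.edgeSet => (Quot.out (e : Sym2 V)).1), Finset.mul_sum]
  refine Finset.sum_le_sum fun v _ => ?_
  have h1 : ∀ e ∈ (Finset.univ : Finset G.edgeSet).filter
      (fun e : G.edgeSet => (Quot.out (e : Sym2 V)).1 = v), f (Quot.out (e : Sym2 V)).1 = f v :=
    fun e he => by rw [(Finset.mem_filter.1 he).2]
  rw [Finset.sum_congr rfl h1, Finset.sum_const, nsmul_eq_mul]
  refine mul_le_mul_of_nonneg_right ?_ (hf v)
  have h2 : ((Finset.univ : Finset G.edgeSet).filter
      (fun e : G.edgeSet => (Quot.out (e : Sym2 V)).1 = v)).card ≤ (G.incidenceFinset v).card := by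
    refine Finset.card_le_card_of_injOn Subtype.val ?_ Subtype.val_injective.injOn
    intro e he
    have he' := (Finset.mem_filter.1 (Finset.mem_coe.1 he)).2
    rw [Finset.mem_coe, SimpleGraph.mem_incidenceFinset]
    refine ⟨e.2, ?_⟩
    rw [← he']
    exact Sym2.out_fst_mem _
  rw [SimpleGraph.card_incidenceFinset_eq_degree] at h2
  exact_mod_cast h2.trans (G.degree_le_maxDegree v)

/-- Concentration of the total excess of a percolated finite graph. -/
lemma measure_sum_excess_ge_le {U : Type*} {Γ : SimpleGraph U} {o : U}
    (hfin : ∀ v, (Γ.neighborSet v).Finite) (p : unitInterval) (G : SimpleGraph V)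
    [DecidableRel G.Adj] {D : ℕ} (hD : ∀ v, (G.neighborSet v).encard ≤ D) {R : ℝ}
    (hR : (D : ℝ) ≤ R) (hP : IsPolyPartition R m P) (hdeg : 2 * m - 2 ≤ h) (hL : 0 ≤ L) {q t : ℝ}
    (hq0 : 0 ≤ q) (hq : ∫ ω, excess P L (percGraph Γ ω) o ∂(edgeLaw Γ p) ≤ q) (ht : 0 ≤ t)
    (hS : 0 < (G.maxDegree : ℝ) * ∑ v, (ballCard G v h : ℝ) ^ 2) :
    (edgeLaw G p).real {ω | Fintype.card V * q + badCount G Γ o h + t ≤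
        ∑ x, excess P L (percGraph G ω) x} ≤
      Real.exp (-(t ^ 2 / (2 * (G.maxDegree * ∑ v, (ballCard G v h : ℝ) ^ 2)))) := by
  classical
  have hPdeg : ∀ j, (P j).natDegree ≤ h := fun j => (hP.natDegree_le j).trans hdeg
  have h01 : ∀ (ω : G.edgeSet → Bool) x, excess P L (percGraph G ω) x ≤ 1 := fun ω x =>
    excess_le_one (encard_neighborSet_percGraph_le hD ω) hR hP hL x
  have hdiff : ∀ (ω : G.edgeSet → Bool) (e : G.edgeSet) (b : Bool),
      |∑ x, excess P L (percGraph G (Function.update ω e b)) x -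
        ∑ x, excess P L (percGraph G ω) x| ≤ (ballCard G (Quot.out (e : Sym2 V)).1 h : ℝ) := by
    intro ω e b
    set u := (Quot.out (e : Sym2 V)).1 with hu
    rw [← Finset.sum_sub_distrib]
    refine (Finset.abs_sum_le_sum_abs _ _).trans ?_
    calc _ ≤ ∑ x, (if x ∈ ballSet G u h then (1 : ℝ) else 0) := by
          refine Finset.sum_le_sum fun x _ => ?_
          split_ifs with hx
          · have := excess_nonneg P L (percGraph G (Function.update ω e b)) x
            have := excess_nonneg P L (percGraph G ω) x
            have := h01 (Function.update ω e b) x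
            have := h01 ω x
            rw [abs_le]
            constructor <;> linarith
          · rw [excess_update_eq x hPdeg ω e b (Sym2.out_fst_mem _), sub_self, abs_zero]
            intro hux
            refine hx ?_
            have h1 : G.edist x u ≤ (h : ℕ∞) := hux
            rw [SimpleGraph.edist_comm] at h1
            exact h1
      _ = ballCard G u h := by
          rw [Finset.sum_boole, ballCard, Set.ncard_eq_toFinset_card']
          congr 2
          ext x
          simp
  have hmean : ∫ ω, ∑ x, excess P L (percGraph G ω) x ∂(edgeLaw G p) ≤
      Fintype.card V * q + badCount G Γ o h := by
    rw [integral_finsetSum _ fun x _ => Integrable.of_finite]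
    calc _ ≤ ∑ x, (q + if ¬ BallIso G x Γ o h then (1 : ℝ) else 0) := by
          refine Finset.sum_le_sum fun x _ => ?_
          split_ifs with hx
          · rw [add_zero, integral_excess_eq_of_ballIso hfin hPdeg p hx]
            exact hq
          · have h1 := integral_mono (μ := edgeLaw G p) (f := fun ω =>
              excess P L (percGraph G ω) x) (g := fun _ => (1 : ℝ)) Integrable.of_finite
              Integrable.of_finite (fun ω => h01 ω x)
            simp only [integral_const, probReal_univ, smul_eq_mul, mul_one] at h1
            linarith
      _ = _ := by
          rw [Finset.sum_add_distrib, Finset.sum_const, Finset.card_univ, nsmul_eq_mul,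
            Finset.sum_boole, badCount, Set.ncard_eq_toFinset_card']
          congr 3
          ext x
          simp
  have hmc := measure_ge_le_of_bounded_differences (bernoulliMeasure true false p)
    (fun e : G.edgeSet => (ballCard G (Quot.out (e : Sym2 V)).1 h : ℝ))
    (fun ω => ∑ x, excess P L (percGraph G ω) x) hdiff ht hS
    (sum_edge_endpoint_le G (fun v => (ballCard G v h : ℝ) ^ 2) fun v => by positivity)
  refine le_trans (measureReal_mono fun ω hω => ?_) hmc
  exact le_trans (add_le_add hmean le_rfl) hω

end Concentration

/-! ### Delocalization -/

lemma encard_neighborSet_le_of_transitive {U : Type*} {Γ : SimpleGraph U} (o : U)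
    (hfin : ∀ x, (Γ.neighborSet x).Finite) (htrans : IsVertexTransitive Γ) (v : U) :
    (Γ.neighborSet v).encard ≤ ((Γ.neighborSet o).ncard : ℕ) := by
  obtain ⟨φ, rfl⟩ := htrans o v
  rw [(hfin o).cast_ncard_eq]
  have : Γ.neighborSet (φ o) = φ '' Γ.neighborSet o := by
    ext z
    constructor
    · intro hz
      refine ⟨φ.symm z, ?_, φ.apply_symm_apply z⟩
      rw [SimpleGraph.mem_neighborSet, ← φ.map_adj_iff, φ.apply_symm_apply]
      exact hz
    · rintro ⟨y, hy, rfl⟩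
      exact φ.map_adj_iff.2 hy
  rw [this]
  exact Set.encard_image_le _ _

/-- Both delocalization statements hold as soon as the total excess is below its expected
threshold: Markov's inequality over the eigenvectors. -/
lemma delocalization_of_sum_excess_lt {V : Type*} [Fintype V] {H : SimpleGraph V}
    {ψ : OrthonormalBasis (Fin (Fintype.card V)) ℂ (EuclideanSpace ℂ V)} (hψ : IsEigenbasis H ψ)
    {D : ℕ} (hD : ∀ v, (H.neighborSet v).encard ≤ D) {m : ℕ} {P : Fin (2 * m) → Polynomial ℝ}
    (hP : IsPolyPartition (D : ℝ) m P) {L κ s ε ε' δ b : ℝ} (hL : 0 ≤ L) (hκ : 0 < κ)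
    (htail : 3 * Real.sqrt (L / (2 * m)) / κ ≤ ε') (hs0 : 0 ≤ s) (hδ0 : 0 < δ)
    (hε : 0 < ε) (hε₁ : ε' ≤ ε / 2) (hε₂ : ε' ≤ (1 - s) / 8) (hb : b ≤ Fintype.card V * δ)
    (hlt : ∑ x, excess P L H x < Fintype.card V * (s + ε') + b + Fintype.card V * δ) :
    (δ ≤ (1 - s) / 8 →
      (1 - s) / 4 * Fintype.card V ≤ (delocalizedCount ((1 - s) / 4) κ ψ : ℝ)) ∧
    (∀ β : ℝ, β = 1 - Real.sqrt (4 * Real.pi * (s + ε + δ)) →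
      β * Fintype.card V ≤ (delocalizedCount β κ ψ : ℝ)) := by
  obtain ⟨lam, hlam⟩ := hψ.exists_hasEigenvalues
  have hsum : ∑ x, ∑ k, (if κ < ‖ψ k x‖ then ‖ψ k x‖ ^ 2 else 0) ≤
      (s + 2 * ε' + 2 * δ) * Fintype.card V := by
    calc _ ≤ ∑ x, (excess P L H x + ε') :=
          Finset.sum_le_sum fun x _ =>
            (sum_large_sq_le_excess hlam hD le_rfl hP hL hκ x).trans (by gcongr)
      _ = ∑ x, excess P L H x + Fintype.card V * ε' := by
          rw [Finset.sum_add_distrib, Finset.sum_const, Finset.card_univ, nsmul_eq_mul]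
      _ ≤ _ := by linarith
  have hpi := Real.pi_gt_three
  constructor
  · intro hc
    have := le_delocalizedCount ψ (θ := 1 - (1 - s) / 4) (by linarith)
      (by nlinarith [sq_nonneg (1 - s)]) hsum
    rwa [sub_sub_cancel] at this
  · rintro β rfl
    have hpos : 0 < 4 * Real.pi * (s + ε + δ) := by positivity
    refine le_delocalizedCount ψ (Real.sqrt_pos.2 hpos) ?_ hsum
    rw [Real.sq_sqrt hpos.le]
    nlinarith

end QuantumPercolation

end

open QuantumPercolation in
theorem theorem6 {U : Type u} (Γ : SimpleGraph U) (o : U)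
    (hfin : ∀ x, (Γ.neighborSet x).Finite)
    (htrans : QuantumPercolation.IsVertexTransitive Γ)
    (p : unitInterval) (hp : 0 < p)
    (hac : 0 < QuantumPercolation.edgeLaw Γ p
      {ω | QuantumPercolation.HasACPart
        (QuantumPercolation.spectralMeasure (QuantumPercolation.percGraph Γ ω) o)})
    (d : ℕ) (hd : 2 ≤ d) (ε : ℝ) (hε : 0 < ε) :
    ∃ c₀ c₁ α ρ : ℝ, 0 < c₀ ∧ 0 < c₁ ∧ 0 < α ∧ 0 < ρ ∧
      ∀ (V : Type v) [Fintype V] (G : SimpleGraph V) [DecidableRel G.Adj],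
        G.maxDegree = d →
        ∀ (h : ℕ) (δ : ℝ), 1 ≤ h →
        max ((h : ℝ) * (QuantumPercolation.badCount G Γ o h : ℝ) / (Fintype.card V : ℝ))
          (1 / (h : ℝ)) ≤ δ →
        1 - δ⁻¹ * (h : ℝ) ^ 2 *
            Real.exp (-((Fintype.card V : ℝ) * δ ^ 2 /
              (2 * (h : ℝ) ^ 2 * QuantumPercolation.ballQuadMean G h ^ 2)))
          ≤ (QuantumPercolation.edgeLaw G p).real
            {ω | ∀ ψ : OrthonormalBasis (Fin (Fintype.card V)) ℂ (EuclideanSpace ℂ V),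
              QuantumPercolation.IsEigenbasis (QuantumPercolation.percGraph G ω) ψ →
              (δ ≤ c₀ →
                α * (Fintype.card V : ℝ) ≤
                  (QuantumPercolation.delocalizedCount ρ
                    (c₁ * Real.sqrt (Real.log (h : ℝ) / (h : ℝ))) ψ : ℝ)) ∧
              (∀ β : ℝ,
                β = 1 - Real.sqrt (4 * Real.pi *
                  (QuantumPercolation.expectedSingularMass Γ o p + ε + δ)) →
                β * (Fintype.card V : ℝ) ≤
                  (QuantumPercolation.delocalizedCount β
                    (c₁ * Real.sqrt (Real.log (h : ℝ) / (h : ℝ))) ψ : ℝ))} := by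
  classical
  set D : ℕ := max d (Γ.neighborSet o).ncard with hDdef
  have hDΓ : ∀ v, (Γ.neighborSet v).encard ≤ D := fun v =>
    (encard_neighborSet_le_of_transitive o hfin htrans v).trans (by exact_mod_cast le_max_right _ _)
  have hdD : (d : ℝ) ≤ D := by exact_mod_cast le_max_left _ _
  have hd0 : (2 : ℝ) ≤ d := by exact_mod_cast hd
  have hD0 : (0 : ℝ) < D := by linarith
  set μs := expectedSingularMass Γ o p with hμs
  have hμs0 : 0 ≤ μs := ENNReal.toReal_nonneg
  have hμs1 : μs < 1 := expectedSingularMass_lt_one hDΓ o p hac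
  -- `ε'` bounds both the density tail and the error from masses below the threshold; the second bound keeps the
  -- total bad mass away from `1`, as the first conclusion needs.
  set ε' : ℝ := min (ε / 2) ((1 - μs) / 8) with hε'
  have hε'0 : 0 < ε' := lt_min (by linarith) (by linarith)
  have hε'1 : ε' ≤ ε / 2 := min_le_left _ _
  have hε'2 : ε' ≤ (1 - μs) / 8 := min_le_right _ _
  obtain ⟨L, hL0, hL⟩ := exists_integral_excess_le hDΓ o p hD0 le_rfl hε'0
  have hlog2 : 0 < Real.log 2 := Real.log_pos one_lt_two
  -- The first term makes the error from masses below the threshold at most `ε'`, the second makes the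
  -- delocalization threshold at least `1` for `2 ≤ h < d`.
  obtain ⟨c₁, hc₁0, hc₁a, hc₁b⟩ : ∃ c₁ : ℝ, 0 < c₁ ∧
      3 * Real.sqrt L / (ε' * Real.sqrt (Real.log 2)) ≤ c₁ ∧ Real.sqrt (d / Real.log 2) ≤ c₁ :=
    ⟨3 * Real.sqrt L / (ε' * Real.sqrt (Real.log 2)) + Real.sqrt (d / Real.log 2), by positivity,
      le_add_of_nonneg_right (Real.sqrt_nonneg _), le_add_of_nonneg_left (by positivity)⟩
  refine ⟨(1 - μs) / 8, c₁, (1 - μs) / 4, (1 - μs) / 4, by linarith, hc₁0, by linarith,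
    by linarith, ?_⟩
  intro V _ G _ hGd h δ hh hδ
  have hh' : (1 : ℝ) ≤ h := by exact_mod_cast hh
  have hδ1 : 1 / (h : ℝ) ≤ δ := (le_max_right _ _).trans hδ
  have hδ0 : 0 < δ := lt_of_lt_of_le (by positivity) hδ1
  have : Nonempty V := by
    by_contra hV
    rw [not_nonempty_iff] at hV
    have : G.maxDegree = 0 := SimpleGraph.maxDegree_of_subsingleton G
    omega
  set n : ℝ := (Fintype.card V : ℝ) with hn
  have hn0 : 0 < n := by
    rw [hn]; exact_mod_cast Fintype.card_pos
  set κ : ℝ := c₁ * Real.sqrt (Real.log h / h) with hκ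
  -- If the good event is everything, the bound on the probability is trivial.
  have htriv : ∀ E : Set (G.edgeSet → Bool), (∀ ω, ω ∈ E) →
      1 - δ⁻¹ * (h : ℝ) ^ 2 * Real.exp (-(n * δ ^ 2 / (2 * (h : ℝ) ^ 2 * ballQuadMean G h ^ 2)))
        ≤ (edgeLaw G p).real E := by
    intro E hE
    rw [Set.eq_univ_of_forall hE, probReal_univ]
    have : 0 ≤ δ⁻¹ * (h : ℝ) ^ 2 *
      Real.exp (-(n * δ ^ 2 / (2 * (h : ℝ) ^ 2 * ballQuadMean G h ^ 2))) := by positivity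
    linarith
  have hpi := Real.pi_gt_three
  have hβ1 : ∀ β : ℝ, β = 1 - Real.sqrt (4 * Real.pi * (μs + ε + δ)) → β ≤ 1 := by
    rintro β rfl
    linarith [Real.sqrt_nonneg (4 * Real.pi * (μs + ε + δ))]
  -- For `1 ≤ δ` the first conclusion has a false hypothesis and `β ≤ 0` in the second one. This
  -- covers `h = 1`, where the delocalization threshold vanishes.
  rcases le_or_gt 1 δ with hδge | hδlt
  · refine htriv _ fun ω ψ _ => ⟨fun hc => by linarith, fun β hβ => ?_⟩
    have h1 : (1 : ℝ) ≤ Real.sqrt (4 * Real.pi * (μs + ε + δ)) := by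
      rw [Real.one_le_sqrt]
      nlinarith
    have h2 : β * n ≤ 0 := mul_nonpos_of_nonpos_of_nonneg (by linarith) hn0.le
    exact h2.trans (Nat.cast_nonneg _)
  have hh2 : 2 ≤ h := by
    by_contra hlt
    have : h = 1 := by omega
    rw [this] at hδ1
    norm_num at hδ1
    linarith
  have hh2' : (2 : ℝ) ≤ h := by exact_mod_cast hh2
  have hlogh : Real.log 2 ≤ Real.log h := Real.log_le_log two_pos hh2'
  rcases lt_or_ge h d with hhd | hhd
  · have hκ1 : 1 ≤ κ := by
      calc (1 : ℝ) = Real.sqrt (d / Real.log 2) * Real.sqrt (Real.log 2 / d) := by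
            rw [← Real.sqrt_mul (by positivity)]
            field_simp
            simp
        _ ≤ κ := by
            have : (h : ℝ) ≤ d := by exact_mod_cast hhd.le
            rw [hκ]
            gcongr
    refine htriv _ fun ω ψ _ => ⟨fun _ => ?_, fun β hβ => ?_⟩
    · rw [delocalizedCount_of_one_le ψ hκ1 (by linarith)]
      exact mul_le_of_le_one_left hn0.le (by linarith)
    · rw [delocalizedCount_of_one_le ψ hκ1 (hβ1 β hβ)]
      exact mul_le_of_le_one_left hn0.le (hβ1 β hβ)
  -- With `m = h / 2 + 1`, the degrees `2 m - 2` are at most `h`, while `h ≤ 2 m`.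
  have hm0 : 0 < h / 2 + 1 := by omega
  obtain ⟨P, hP⟩ := exists_isPolyPartition hD0 hm0
  have hDG : ∀ v, (G.neighborSet v).encard ≤ D := by
    intro v
    rw [← SimpleGraph.coe_neighborFinset, Set.encard_coe_eq_coe_finsetCard,
      SimpleGraph.card_neighborFinset_eq_degree]
    exact_mod_cast (G.degree_le_maxDegree v).trans (hGd.le.trans (le_max_left _ _))
  have hball : ∀ v, (1 : ℝ) ≤ ballCard G v h := by
    intro v
    have : 0 < ballCard G v h :=
      (Set.ncard_pos (Set.toFinite _)).2 ⟨v, mem_ballSet_self G v h⟩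
    exact_mod_cast this
  set S₂ : ℝ := ∑ v, (ballCard G v h : ℝ) ^ 2 with hS
  have hS0 : 0 < S₂ := Finset.sum_pos (fun v _ => by have := hball v; positivity)
    Finset.univ_nonempty
  have hM2 : ballQuadMean G h ^ 2 = S₂ / n := by
    rw [ballQuadMean, Real.sq_sqrt (by positivity)]
    ring
  have hconc := measure_sum_excess_ge_le (L := L) hfin p G hDG le_rfl hP (h := h) (by omega) hL0.le
    (q := μs + ε') (t := n * δ) (by linarith) (hL _ _ hP) (by positivity)
    (by rw [hGd]; positivity)
  rw [hGd] at hconc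
  set Bad : Set (G.edgeSet → Bool) := {ω | n * (μs + ε') + badCount G Γ o h + n * δ ≤
    ∑ x, excess P L (percGraph G ω) x} with hBad
  have hexp : (edgeLaw G p).real Bad ≤ δ⁻¹ * (h : ℝ) ^ 2 *
      Real.exp (-(n * δ ^ 2 / (2 * (h : ℝ) ^ 2 * ballQuadMean G h ^ 2))) := by
    have hdh : (d : ℝ) ≤ (h : ℝ) ^ 2 := by
      have : (d : ℝ) ≤ h := by exact_mod_cast hhd
      nlinarith
    have h1 : n * δ ^ 2 / (2 * (h : ℝ) ^ 2 * ballQuadMean G h ^ 2) ≤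
        (n * δ) ^ 2 / (2 * (d * S₂)) := by
      rw [hM2]
      have : n * δ ^ 2 / (2 * (h : ℝ) ^ 2 * (S₂ / n)) =
          (n * δ) ^ 2 / (2 * ((h : ℝ) ^ 2 * S₂)) := by
        field_simp
      rw [this]
      gcongr
    have h2 : 1 ≤ δ⁻¹ * (h : ℝ) ^ 2 := by
      have : 1 ≤ δ⁻¹ := (one_le_inv₀ hδ0).2 hδlt.le
      nlinarith
    refine hconc.trans ((Real.exp_le_exp.2 (neg_le_neg h1)).trans ?_)
    exact le_mul_of_one_le_left (Real.exp_pos _).le h2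
  have hbadcount : (badCount G Γ o h : ℝ) ≤ n * δ := by
    have h1 := (le_max_left _ _).trans hδ
    rw [div_le_iff₀ hn0] at h1
    have : (badCount G Γ o h : ℝ) ≤ h * badCount G Γ o h :=
      le_mul_of_one_le_left (Nat.cast_nonneg _) hh'
    linarith
  have hκ0 : 0 < κ := by
    have : 0 < Real.log h := hlog2.trans_le hlogh
    positivity
  have htail : 3 * Real.sqrt (L / (2 * ((h / 2 + 1 : ℕ) : ℝ))) / κ ≤ ε' := by
    have h1 : (h : ℝ) ≤ 2 * ((h / 2 + 1 : ℕ) : ℝ) := by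
      exact_mod_cast (by omega : h ≤ 2 * (h / 2 + 1))
    rw [div_le_iff₀ hκ0]
    calc 3 * Real.sqrt (L / (2 * ((h / 2 + 1 : ℕ) : ℝ))) ≤ 3 * Real.sqrt (L / h) := by gcongr
      _ = ε' * (3 * Real.sqrt L / (ε' * Real.sqrt (Real.log 2)) *
            Real.sqrt (Real.log 2 / h)) := by
          rw [Real.sqrt_div hL0.le, Real.sqrt_div hlog2.le]
          field_simp
      _ ≤ ε' * κ :=
          mul_le_mul_of_nonneg_left (mul_le_mul hc₁a (Real.sqrt_le_sqrt (by gcongr))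
            (Real.sqrt_nonneg _) hc₁0.le) hε'0.le
  have hsub : Badᶜ ⊆ {ω | ∀ ψ : OrthonormalBasis (Fin (Fintype.card V)) ℂ (EuclideanSpace ℂ V),
      IsEigenbasis (percGraph G ω) ψ →
      (δ ≤ (1 - μs) / 8 → (1 - μs) / 4 * n ≤ (delocalizedCount ((1 - μs) / 4) κ ψ : ℝ)) ∧
      (∀ β : ℝ, β = 1 - Real.sqrt (4 * Real.pi * (μs + ε + δ)) →
        β * n ≤ (delocalizedCount β κ ψ : ℝ))} := by
    intro ω hω ψ hψ
    exact delocalization_of_sum_excess_lt hψ (encard_neighborSet_percGraph_le hDG ω) hP hL0.le hκ0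
      htail hμs0 hδ0 hε hε'1 hε'2 hbadcount (not_le.1 hω)
  have hcompl : (edgeLaw G p).real Badᶜ = 1 - (edgeLaw G p).real Bad :=
    probReal_compl_eq_one_sub MeasurableSet.of_discrete
  have hmono := measureReal_mono (μ := edgeLaw G p) hsub
  linarith
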